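/- Let $n\ge 1$. Let $\mathrm{Conv}_c(\mathbb R^n)$ be the set of convex, lower semicontinuous functions $\psi:\mathbb R^n\to(-\infty,+\infty]$ with $\psi\not\equiv+\infty$ and $\lim_{\|x\|\to\infty}\psi(x)=+\infty$. For a unit vector $u$ put $R_u(x)=x-2\langle x,u\rangle u$ and $R_uf=f\circ R_u$. The Minkowski symmetral of $\psi$ is $$(\tau_u\psi)(x)=\inf_{y+z=x}\left\{\tfrac12\psi(2y)+\tfrac12(R_u\psi)(2z)\right\}.$$ A sequence $\psi_j$ epi-converges to $\psi$ if for every $x$: $\psi(x)\le\liminf_j\psi_j(x_j)$ for every sequence $x_j\to x$, and $\psi(x)=\lim_j\psi_j(x_j)$ for at least one sequence $x_j\to x$; $f_j$ hypo-converges to $f$ if $-f_j$ epi-converges to $-f$. A function on $\mathbb R^n$ is called rotation invariant if it is invariant under all linear isometries. (1) For every $\psi\in\mathrm{Conv}_c(\mathbb R^n)$ there are unit vectors $u_1,u_2,\dots$ such that $\tau_{u_m}\cdots\tau_{u_1}\psi$ epi-converges, as $m\to\infty$, to a rotation-invariant function $\psi_{\rm sym}\in\mathrm{Conv}_c(\mathbb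 R^n)$. Every function $\psi_{\rm sym}$ arising in this way is called an epi-symmetrization of $\psi$. (2) Let $\alpha\in\mathbb R$. A function $f:\mathbb R^n\to[0,\infty)$ is $\alpha$-concave if $\operatorname{supp} f=\{f>0\}$ is convex and $f(\lambda x+(1-\lambda)y)\ge(\lambda f(x)^\alpha+(1-\lambda)f(y)^\alpha)^{1/\alpha}$ (read as $f(x)^\lambda f(y)^{1-\lambda}$ if $\alpha=0$) for all $x,y\in\operatorname{supp} f$ and $\lambda\in[0,1]$. Let $\mathcal C_\alpha(\mathbb R^n)$ be the set of $\alpha$-concave, upper semicontinuous $f\not\equiv0$ with $\dim(\operatorname{supp} f)=n$ and $\lim_{\|x\|\to\infty}f(x)=0$. The base function of $f$ is $\mathrm{base}_\alpha f=(1-f^\alpha)/\alpha$ for $\alpha\ne0$ and $\mathrm{base}_0f=-\log f$, with the value $+\infty$ at the zeros of $f$ if $\alpha\le 0$, and with the value $+\infty$ off the closure of $\operatorname{supp} f$ if $\alpha>0$. Conversely a function $\psi$ determines $(1-\alpha\psi)_+^{1/\alpha}$ (read as $e^{-\psi}$ if $\alpha=0$, and as $0$ where $\psi=+\infty$). The $\alpha$-Asplund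 sum $f\star_\alpha g$ and the homothety $\lambda\cdot_\alpha f$ are the functions determined by the infimal convolution of $\mathrm{base}_\alpha f$ and $\mathrm{base}_\alpha g$ and by $x\mapsto\lambda\,(\mathrm{base}_\alpha f)(x/\lambda)$, respectively, and the $\alpha$-Minkowski symmetral of $f$ is $\tau^\alpha_uf=\frac12\cdot_\alpha f\star_\alpha\frac12\cdot_\alpha R_uf$. A hypo-symmetrization of $f$ is a function $f_{\rm sym}=(1-\alpha\psi_{\rm sym})_+^{1/\alpha}$ with $\psi_{\rm sym}$ an epi-symmetrization of $\mathrm{base}_\alpha f$. Every $f\in\mathcal C_\alpha(\mathbb R^n)$ has a hypo-symmetrization, and every hypo-symmetrization $f_{\rm sym}$ of $f$ is rotation invariant, belongs to $\mathcal C_\alpha(\mathbb R^n)$, and is the hypo-limit of $\tau^\alpha_{u_m}\cdots\tau^\alpha_{u_1}f$ for some sequence of unit vectors $u_1,u_2,\dots$. For $\alpha=0$ the same holds with $\mathcal C_0(\mathbb R^n)$ replaced by $\mathrm{LC}_c(\mathbb R^n)=\{e^{-\psi}:\psi\in\mathrm{Conv}_c(\mathbb R^n)\}$. -/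

import Mathlib

open Filter Topology

namespace MinkSymm

noncomputable section

/-- `ℝⁿ` with its Euclidean structure. -/
abbrev E (n : ℕ) : Type := EuclideanSpace ℝ (Fin n)

variable {n : ℕ}

/-! ### Extended-real-valued convex functions -/

/-- The class `Conv_c(ℝⁿ)`: functions `ℝⁿ → (-∞, +∞]` that are convex (convex epigraph), proper,
lower semicontinuous and coercive. -/
structure IsConvC (ψ : E n → EReal) : Prop where
  convex : Convex ℝ {p : E n × ℝ | ψ p.1 ≤ (p.2 : EReal)}
  ne_bot : ∀ x, ψ x ≠ ⊥
  dom_nonempty : ∃ x, ψ x ≠ ⊤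
  lsc : LowerSemicontinuous ψ
  coercive : Tendsto ψ (cocompact (E n)) (𝓝 ⊤)

/-- Infimal convolution `(φ □ ψ)(x) = inf_{y + z = x} (φ(y) + ψ(z))`. -/
def infConv (φ ψ : E n → EReal) (x : E n) : EReal := ⨅ y : E n, φ y + ψ (x - y)

/-- Epi-multiplication `x ↦ c ψ(x / c)` (used for `c > 0`). -/
def epiMul (c : ℝ) (ψ : E n → EReal) (x : E n) : EReal := (c : EReal) * ψ (c⁻¹ • x)

/-- The reflection `R_u(x) = x - 2⟨x, u⟩u` about the hyperplane `u^⊥` (`u` a unit vector). -/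
def reflect (u x : E n) : E n := x - (2 * inner ℝ x u) • u

/-- The reflection `R_u f = f ∘ R_u` of a function. -/
def reflectFun {β : Type*} (u : E n) (f : E n → β) (x : E n) : β := f (reflect u x)

/-- The Minkowski symmetral `τ_u ψ` of a convex function. -/
def symmetral (u : E n) (ψ : E n → EReal) : E n → EReal :=
  infConv (epiMul (1 / 2) ψ) (epiMul (1 / 2) (reflectFun u ψ))

/-- Successive Minkowski symmetrals: `iterSymmetral u ψ m = τ_{u (m-1)} ⋯ τ_{u 0} ψ`. -/
def iterSymmetral (u : ℕ → E n) (ψ : E n → EReal) : ℕ → E n → EReal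
  | 0 => ψ
  | m + 1 => symmetral (u m) (iterSymmetral u ψ m)

/-- Epi-convergence of a sequence of extended-real-valued functions. -/
def EpiConverges (ψs : ℕ → E n → EReal) (ψ : E n → EReal) : Prop :=
  ∀ x : E n,
    (∀ xs : ℕ → E n, Tendsto xs atTop (𝓝 x) →
      ψ x ≤ liminf (fun j => ψs j (xs j)) atTop) ∧
    ∃ xs : ℕ → E n, Tendsto xs atTop (𝓝 x) ∧
      Tendsto (fun j => ψs j (xs j)) atTop (𝓝 (ψ x))

/-- Invariance under all linear isometries of `ℝⁿ`. -/
def RotationInvariant {β : Type*} (f : E n → β) : Prop :=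
  ∀ (T : E n ≃ₗᵢ[ℝ] E n) (x : E n), f (T x) = f x

/-- `φ` is an epi-symmetrization `ψ_sym` of `ψ`: a rotation-invariant member of `Conv_c(ℝⁿ)` which
is the epi-limit of successive Minkowski symmetrals of `ψ`. -/
def IsEpiSymmetrization (ψ φ : E n → EReal) : Prop :=
  IsConvC φ ∧ RotationInvariant φ ∧
    ∃ u : ℕ → E n, (∀ i, ‖u i‖ = 1) ∧ EpiConverges (iterSymmetral u ψ) φ

/-! ### `α`-concave functions -/

/-- The `α`-mean `M_α^{(s,t)}(a,b)` for real `α` and `a, b > 0`. -/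
def alphaMean (α s t a b : ℝ) : ℝ :=
  if α = 0 then a ^ s * b ^ t else (s * a ^ α + t * b ^ α) ^ (1 / α)

/-- `α`-concavity of a nonnegative function, with support `{f ≠ 0} = {f > 0}`. -/
def AlphaConcave (α : ℝ) (f : E n → ℝ) : Prop :=
  Convex ℝ (Function.support f) ∧
    ∀ x ∈ Function.support f, ∀ y ∈ Function.support f, ∀ t ∈ Set.Icc (0 : ℝ) 1,
      alphaMean α t (1 - t) (f x) (f y) ≤ f (t • x + (1 - t) • y)

/-- The class `C_α(ℝⁿ)`. -/
structure IsAlphaClass (α : ℝ) (f : E n → ℝ) : Prop where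
  nonneg : ∀ x, 0 ≤ f x
  concave : AlphaConcave α f
  proper : ∃ x, f x ≠ 0
  usc : UpperSemicontinuous f
  full_dim : affineSpan ℝ (Function.support f) = ⊤
  vanish : Tendsto f (cocompact (E n)) (𝓝 0)

/-- The base function `base_α f`: `(1 - f^α)/α` for `α ≠ 0` and `-log f` for `α = 0`.
Where `f = 0` and `α ≤ 0` the value is `+∞`. For `α > 0` the value is `+∞` off the closure of the
support of `f` (so that the base function of the characteristic function of a convex body `K` is `0`
on `K` and `+∞` off `K`), and `1/α` at the zeros of `f` in that closure, as lower semicontinuity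
requires. -/
def baseFn (α : ℝ) (f : E n → ℝ) (x : E n) : EReal :=
  open Classical in
  if 0 < α then
    if x ∈ closure (Function.support f) then (((1 - f x ^ α) / α : ℝ) : EReal) else ⊤
  else if f x = 0 then ⊤
  else if α = 0 then ((-Real.log (f x) : ℝ) : EReal)
  else (((1 - f x ^ α) / α : ℝ) : EReal)

/-- The function `(1 - αψ)_+^{1/α}` with base function `ψ`, read as `e^{-ψ}` for `α = 0`; it
vanishes where `ψ = +∞`. For `α < 0` it is meant for `ψ > 1/α`, where the power is finite. -/
def ofBase (α : ℝ) (ψ : E n → EReal) (x : E n) : ℝ :=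
  open Classical in
  if ψ x = ⊤ then 0
  else if α = 0 then Real.exp (-(ψ x).toReal)
  else (max (1 - α * (ψ x).toReal) 0) ^ (1 / α)

/-- The `α`-Asplund sum `f ⋆_α g`, whose base function is `base_α f □ base_α g`. -/
def asplund (α : ℝ) (f g : E n → ℝ) : E n → ℝ :=
  ofBase α (infConv (baseFn α f) (baseFn α g))

/-- The `(α, c)`-homothety `c ·_α f`, whose base function is the epi-multiple of `base_α f`. -/
def homothety (α c : ℝ) (f : E n → ℝ) : E n → ℝ :=
  ofBase α (epiMul c (baseFn α f))

/-- The `α`-Minkowski symmetral `τ_u^α f = ½ ·_α f ⋆_α ½ ·_α R_u f`. -/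
def alphaSymmetral (α : ℝ) (u : E n) (f : E n → ℝ) : E n → ℝ :=
  asplund α (homothety α (1 / 2) f) (homothety α (1 / 2) (reflectFun u f))

/-- Successive `α`-Minkowski symmetrals: `τ^α_{u (m-1)} ⋯ τ^α_{u 0} f`. -/
def iterAlphaSymmetral (α : ℝ) (u : ℕ → E n) (f : E n → ℝ) : ℕ → E n → ℝ
  | 0 => f
  | m + 1 => alphaSymmetral α (u m) (iterAlphaSymmetral α u f m)

/-- Hypo-convergence of real-valued functions; the upper limit is taken in `[-∞, +∞]`. -/
def HypoConverges (fs : ℕ → E n → ℝ) (f : E n → ℝ) : Prop :=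
  ∀ x : E n,
    (∀ xs : ℕ → E n, Tendsto xs atTop (𝓝 x) →
      limsup (fun j => ((fs j (xs j) : ℝ) : EReal)) atTop ≤ ((f x : ℝ) : EReal)) ∧
    ∃ xs : ℕ → E n, Tendsto xs atTop (𝓝 x) ∧
      Tendsto (fun j => fs j (xs j)) atTop (𝓝 (f x))

/-- `g` is a hypo-symmetrization `f_sym = (1 - α ψ_sym)_+^{1/α}` of `f`, where `ψ_sym` is an
epi-symmetrization of the base function of `f`. -/
def IsHypoSymmetrization (α : ℝ) (f g : E n → ℝ) : Prop :=
  ∃ φ : E n → EReal, IsEpiSymmetrization (baseFn α f) φ ∧ g = ofBase α φ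

/-- The class `LC_c(ℝⁿ)` of functions `e^{-ψ}` with `ψ ∈ Conv_c(ℝⁿ)`. -/
def IsLCc (f : E n → ℝ) : Prop := ∃ ψ : E n → EReal, IsConvC ψ ∧ f = ofBase 0 ψ

end

end MinkSymm

open MinkSymm

/-!
The Legendre conjugate turns the Minkowski symmetral `τ_u ψ` into the average of `ψ*` and
`ψ* ∘ R_u`. Averaging over a reflection decreases the `L²`-norm on every centred ball, strictly
unless the function is invariant. Choosing each direction so that the decrease is nearly optimal,
for one member of a countable dense family of continuous functions at a time, gives one sequence of
reflections whose successive averages converge locally uniformly to a radial function, whichever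
continuous function they start from.

Hence the conjugates of the iterated symmetrals converge on the largest centred open ball where
`ψ*` is finite, while outside its closure the value `+∞` spreads over whole spheres. Separating
epigraphs from concave functions turns this into epi-convergence of the symmetrals to the conjugate
of the limit.

Functions and their base functions are related by a decreasing continuous change of scale, which
carries symmetrals to symmetrals and epi-limits to hypo-limits. The limit has full dimension because
its sublevel sets are rotation invariant and one of them contains a point other than the origin.
-/

namespace MinkSymm

section Reflection

variable {n : ℕ} {u : E n}

lemma reflect_eq_reflection (hu : ‖u‖ = 1) (x : E n) : reflect u x = (ℝ ∙ u)ᗮ.reflection x := by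
  rw [Submodule.reflection_orthogonal_apply, Submodule.reflection_singleton_apply, hu, reflect,
    real_inner_comm, two_smul, mul_smul, two_smul]
  simp

lemma continuous_reflect (u : E n) : Continuous (reflect u) := by
  unfold reflect
  fun_prop

lemma reflect_add (u x y : E n) : reflect u (x + y) = reflect u x + reflect u y := by
  simp only [reflect, inner_add_left, mul_add, add_smul]
  abel

lemma reflect_smul (u : E n) (c : ℝ) (x : E n) : reflect u (c • x) = c • reflect u x := by
  simp only [reflect, real_inner_smul_left, smul_sub, smul_smul]
  congr 2
  ring

lemma reflect_reflect (hu : ‖u‖ = 1) (x : E n) : reflect u (reflect u x) = x := by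
  simp only [reflect_eq_reflection hu, Submodule.reflection_reflection]

lemma norm_reflect (hu : ‖u‖ = 1) (x : E n) : ‖reflect u x‖ = ‖x‖ := by
  rw [reflect_eq_reflection hu, LinearIsometryEquiv.norm_map]

lemma dist_reflect (hu : ‖u‖ = 1) (x y : E n) : dist (reflect u x) (reflect u y) = dist x y := by
  simp only [reflect_eq_reflection hu, LinearIsometryEquiv.dist_map]

lemma measurePreserving_reflect (hu : ‖u‖ = 1) : MeasureTheory.MeasurePreserving (reflect u) := by
  rw [show reflect u = (ℝ ∙ u)ᗮ.reflection from funext (reflect_eq_reflection hu)]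
  exact (ℝ ∙ u)ᗮ.reflection.measurePreserving

lemma measurableEmbedding_reflect (hu : ‖u‖ = 1) : MeasurableEmbedding (reflect u) := by
  rw [show reflect u = (ℝ ∙ u)ᗮ.reflection from funext (reflect_eq_reflection hu)]
  exact (ℝ ∙ u)ᗮ.reflection.toMeasurableEquiv.measurableEmbedding

lemma preimage_reflect_ball (hu : ‖u‖ = 1) (R : ℝ) :
    reflect u ⁻¹' Metric.ball 0 R = Metric.ball 0 R := by
  ext x
  simp only [Set.mem_preimage, mem_ball_zero_iff, norm_reflect hu]

lemma inner_reflect_left (u x y : E n) : inner ℝ (reflect u x) y = inner ℝ x (reflect u y) := by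
  simp only [reflect, inner_sub_left, inner_sub_right, real_inner_smul_left,
    real_inner_smul_right, real_inner_comm u y]
  ring

lemma exists_norm_eq_one (hn : 0 < n) : ∃ u : E n, ‖u‖ = 1 :=
  ⟨EuclideanSpace.single ⟨0, hn⟩ 1, by simp⟩

lemma exists_reflect_eq {x y : E n} (h : ‖x‖ = ‖y‖) (hxy : x ≠ y) :
    ∃ u : E n, ‖u‖ = 1 ∧ reflect u x = y := by
  have h0 : ‖x - y‖ ≠ 0 := norm_ne_zero_iff.2 (sub_ne_zero.2 hxy)
  have hu : ‖‖x - y‖⁻¹ • (x - y)‖ = 1 := by rw [norm_smul, norm_inv, norm_norm, inv_mul_cancel₀ h0]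
  have hspan := Submodule.span_singleton_smul_eq (inv_ne_zero h0).isUnit (x - y)
  exact ⟨_, hu, by simp only [reflect_eq_reflection hu, hspan, Submodule.reflection_sub h]⟩

end Reflection

section Averages

open MeasureTheory

variable {n : ℕ}

/-- The average `½ (f + f ∘ R_u)`, as a continuous linear operator for locally uniform
convergence. -/
noncomputable def reflAvg (u : E n) : C(E n, ℝ) →L[ℝ] C(E n, ℝ) where
  toFun f := (2⁻¹ : ℝ) • (f + f.comp ⟨reflect u, continuous_reflect u⟩)
  map_add' f g := by ext x; simp; ring
  map_smul' c f := by ext x; simp; ring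
  cont := by fun_prop

lemma reflAvg_apply (u : E n) (f : C(E n, ℝ)) (x : E n) :
    reflAvg u f x = (f x + f (reflect u x)) / 2 := by
  change 2⁻¹ * (f x + f (reflect u x)) = _
  ring

/-- The successive averages over the reflections `R_{u 0}, …, R_{u (m - 1)}`, in this order. -/
noncomputable def iterReflAvg (u : ℕ → E n) : ℕ → C(E n, ℝ) →L[ℝ] C(E n, ℝ)
  | 0 => .id ℝ _
  | m + 1 => (reflAvg (u m)).comp (iterReflAvg u m)

lemma iterReflAvg_succ_apply (u : ℕ → E n) (f : C(E n, ℝ)) (m : ℕ) (x : E n) :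
    iterReflAvg u (m + 1) f x =
      (iterReflAvg u m f x + iterReflAvg u m f (reflect (u m) x)) / 2 :=
  reflAvg_apply _ _ _

/-- Invariance of `g` under all reflections, on the centred ball of radius `R`. -/
def IsReflInvariantOn (R : ℝ) (g : E n → ℝ) : Prop :=
  ∀ v : E n, ‖v‖ = 1 → ∀ x, ‖x‖ < R → g (reflect v x) = g x

variable {u : ℕ → E n} (hu : ∀ i, ‖u i‖ = 1)

include hu in
lemma abs_iterReflAvg_sub_le {f : C(E n, ℝ)} {g : E n → ℝ} {R ε : ℝ} (hg : IsReflInvariantOn R g)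
    {m k : ℕ} (h : ∀ x, ‖x‖ < R → |iterReflAvg u m f x - g x| ≤ ε) (hmk : m ≤ k) :
    ∀ x, ‖x‖ < R → |iterReflAvg u k f x - g x| ≤ ε := by
  induction k, hmk using Nat.le_induction with
  | base => exact h
  | succ k _ ih =>
    intro x hx
    have h1 := abs_le.1 (ih x hx)
    have h2 := abs_le.1 (ih (reflect (u k) x) (by rwa [norm_reflect (hu k)]))
    rw [hg _ (hu k) x hx] at h2
    rw [iterReflAvg_succ_apply, abs_le]
    constructor <;> linarith

include hu in
lemma abs_iterReflAvg_le {f : C(E n, ℝ)} {R M : ℝ} (h : ∀ x, ‖x‖ < R → |f x| ≤ M) (m : ℕ) :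
    ∀ x, ‖x‖ < R → |iterReflAvg u m f x| ≤ M := by
  simpa using abs_iterReflAvg_sub_le hu (g := 0) (fun _ _ _ _ => rfl)
    (m := 0) (by simpa [iterReflAvg] using h) m.zero_le

include hu in
lemma abs_iterReflAvg_sub_iterReflAvg_le {f : C(E n, ℝ)} {R δ ε : ℝ}
    (h : ∀ x y, ‖x‖ < R → ‖y‖ < R → dist x y < δ → |f x - f y| ≤ ε) (m : ℕ) :
    ∀ x y, ‖x‖ < R → ‖y‖ < R → dist x y < δ →
      |iterReflAvg u m f x - iterReflAvg u m f y| ≤ ε := by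
  induction m with
  | zero => simpa [iterReflAvg] using h
  | succ m ih =>
    intro x y hx hy hxy
    have h1 := abs_le.1 (ih x y hx hy hxy)
    have h2 := abs_le.1 (ih (reflect (u m) x) (reflect (u m) y) (by rwa [norm_reflect (hu m)])
      (by rwa [norm_reflect (hu m)]) (by rwa [dist_reflect (hu m)]))
    rw [iterReflAvg_succ_apply, iterReflAvg_succ_apply, abs_le]
    constructor <;> linarith

include hu in
lemma equicontinuous_iterReflAvg (f : C(E n, ℝ)) :
    Equicontinuous fun m => (iterReflAvg u m f : E n → ℝ) := by
  intro x
  rw [Metric.equicontinuousAt_iff]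
  intro ε hε
  have hcpt : IsCompact (Metric.closedBall (0 : E n) (‖x‖ + 1)) := isCompact_closedBall 0 _
  obtain ⟨δ, hδ, h⟩ := Metric.uniformContinuousOn_iff.1
    (hcpt.uniformContinuousOn_of_continuous f.continuous.continuousOn) (ε / 2) (half_pos hε)
  have hf : ∀ y z, ‖y‖ < ‖x‖ + 1 → ‖z‖ < ‖x‖ + 1 → dist y z < δ → |f y - f z| ≤ ε / 2 :=
    fun y z hy hz hyz => (h y (by simpa using hy.le) z (by simpa using hz.le) hyz).le
  refine ⟨min δ 1, lt_min hδ one_pos, fun y hy m => ?_⟩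
  have hyx : ‖y‖ < ‖x‖ + 1 := by
    have := norm_le_norm_add_norm_sub' y x
    rw [← dist_eq_norm] at this
    linarith [hy.trans_le (min_le_right _ _)]
  rw [dist_comm, Real.dist_eq]
  have := abs_iterReflAvg_sub_iterReflAvg_le hu hf m y x hyx (by linarith)
    (hy.trans_le (min_le_left _ _))
  linarith

include hu in
lemma isCompact_closure_range_iterReflAvg (f : C(E n, ℝ)) :
    IsCompact (closure (Set.range fun m => iterReflAvg u m f)) := by
  have : T2Space (UniformOnFun (E n) ℝ {K | IsCompact K}) :=
    UniformOnFun.t2Space_of_covering <|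
      Set.sUnion_eq_univ_iff.2 fun x => ⟨{x}, isCompact_singleton, rfl⟩
  refine ArzelaAscoli.isCompact_closure_of_isClosedEmbedding (𝔖 := {K | IsCompact K})
    (F := fun g : C(E n, ℝ) => (g : E n → ℝ)) (fun _ hK => hK)
    ContinuousMap.isUniformEmbedding_toUniformOnFunIsCompact.isClosedEmbedding
    (fun K _ => ?_) fun K _ x _ => ?_
  · rintro x hx V hV
    filter_upwards [(equicontinuous_iterReflAvg hu f).equicontinuousOn K x hx V hV] with y hy
    rintro ⟨_, m, rfl⟩
    exact hy m
  · obtain ⟨M, hM⟩ := (isCompact_closedBall (0 : E n) (‖x‖ + 1)).exists_bound_of_continuousOn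
      f.continuous.continuousOn
    refine ⟨Set.Icc (-M) M, isCompact_Icc, ?_⟩
    rintro _ ⟨m, rfl⟩
    exact abs_le.1 (abs_iterReflAvg_le hu (fun y hy => hM y (by simpa using hy.le)) m x
      (lt_add_one _))

lemma tendsto_continuousMap_iff {ι : Type*} {l : Filter ι} {F : ι → C(E n, ℝ)} {g : C(E n, ℝ)} :
    Tendsto F l (𝓝 g) ↔
      ∀ R, ∀ ε > 0, ∀ᶠ i in l, ∀ x, ‖x‖ < R → |F i x - g x| < ε := by
  rw [ContinuousMap.tendsto_iff_forall_isCompact_tendstoUniformlyOn]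
  constructor
  · intro h R ε hε
    filter_upwards [Metric.tendstoUniformlyOn_iff.1 (h _ (isCompact_closedBall 0 R)) ε hε]
      with i hi x hx
    rw [abs_sub_comm]
    exact hi x (mem_closedBall_zero_iff.2 hx.le)
  · intro h K hK
    obtain ⟨R, hR⟩ := hK.isBounded.exists_norm_le
    rw [Metric.tendstoUniformlyOn_iff]
    intro ε hε
    filter_upwards [h (R + 1) ε hε] with i hi x hx
    rw [dist_comm]
    exact hi x ((hR x hx).trans_lt (lt_add_one R))

/-- The integral of `f` over the centred ball of radius `R`. -/
noncomputable def ballIntegral (R : ℝ) (f : C(E n, ℝ)) : ℝ := ∫ x in Metric.ball 0 R, f x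

lemma integrableOn_ball (R : ℝ) {f : E n → ℝ} (hf : Continuous f) :
    IntegrableOn f (Metric.ball 0 R) :=
  (hf.continuousOn.integrableOn_compact (isCompact_closedBall 0 R)).mono_set
    Metric.ball_subset_closedBall

lemma continuous_ballIntegral (R : ℝ) : Continuous (ballIntegral (n := n) R) := by
  refine continuous_iff_continuousAt.2 fun g =>
    continuousAt_of_dominated (bound := fun x => |g x| + 1)
    (.of_forall fun f => f.continuous.aestronglyMeasurable) ?_
    (integrableOn_ball R (by fun_prop))
    (.of_forall fun x => (continuous_eval_const x).continuousAt)
  filter_upwards [tendsto_continuousMap_iff.1 tendsto_id R 1 one_pos] with f hf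
  refine ae_restrict_of_forall_mem Metric.isOpen_ball.measurableSet fun x hx => ?_
  have := abs_sub_abs_le_abs_sub (f x) (g x)
  have := hf x (mem_ball_zero_iff.1 hx)
  rw [id] at this
  rw [Real.norm_eq_abs]
  linarith

lemma ballIntegral_pos {f : C(E n, ℝ)} (hf : ∀ x, 0 ≤ f x) {R : ℝ} {y : E n} (hy : ‖y‖ < R)
    (hpos : 0 < f y) : 0 < ballIntegral R f := by
  rw [ballIntegral, setIntegral_pos_iff_support_of_nonneg_ae (ae_of_all _ hf)
    (integrableOn_ball R f.continuous)]
  exact (f.continuous.isOpen_support.inter Metric.isOpen_ball).measure_pos _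
    ⟨y, hpos.ne', mem_ball_zero_iff.2 hy⟩

lemma setIntegral_reflect {u : E n} (hu : ‖u‖ = 1) (R : ℝ) (f : E n → ℝ) :
    ∫ x in Metric.ball 0 R, f (reflect u x) = ∫ x in Metric.ball 0 R, f x := by
  conv_lhs => rw [← preimage_reflect_ball hu R]
  exact (measurePreserving_reflect hu).setIntegral_preimage_emb (measurableEmbedding_reflect hu) _ _

lemma ballIntegral_reflAvg {u : E n} (hu : ‖u‖ = 1) (R : ℝ) (f : C(E n, ℝ)) :
    ballIntegral R (reflAvg u f) = ballIntegral R f := by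
  have hf : Continuous fun x => f (reflect u x) := f.continuous.comp (continuous_reflect u)
  simp only [ballIntegral, reflAvg_apply]
  rw [integral_div, integral_add (integrableOn_ball R f.continuous) (integrableOn_ball R hf),
    setIntegral_reflect hu, add_self_div_two]

include hu in
lemma ballIntegral_iterReflAvg (R : ℝ) (f : C(E n, ℝ)) (m : ℕ) :
    ballIntegral R (iterReflAvg u m f) = ballIntegral R f := by
  induction m with
  | zero => rfl
  | succ m ih => exact (ballIntegral_reflAvg (hu m) R _).trans ih

lemma ballIntegral_sq_reflAvg {u : E n} (hu : ‖u‖ = 1) (R : ℝ) (f : C(E n, ℝ)) :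
    ballIntegral R (reflAvg u f ^ 2) =
      ballIntegral R (f ^ 2) - (∫ x in Metric.ball 0 R, (f x - f (reflect u x)) ^ 2) / 4 := by
  have hr := continuous_reflect u
  have hsq : ∀ x, (reflAvg u f ^ 2) x =
      f x ^ 2 / 2 + f (reflect u x) ^ 2 / 2 - (f x - f (reflect u x)) ^ 2 / 4 := fun x => by
    rw [ContinuousMap.pow_apply, reflAvg_apply]
    ring
  simp only [ballIntegral, hsq, ContinuousMap.pow_apply]
  rw [integral_sub (integrableOn_ball R (by fun_prop)) (integrableOn_ball R (by fun_prop)),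
    integral_add (integrableOn_ball R (by fun_prop)) (integrableOn_ball R (by fun_prop)),
    integral_div, integral_div, integral_div, setIntegral_reflect hu R (fun x => f x ^ 2)]
  ring

lemma ballIntegral_sq_reflAvg_le {u : E n} (hu : ‖u‖ = 1) (R : ℝ) (f : C(E n, ℝ)) :
    ballIntegral R (reflAvg u f ^ 2) ≤ ballIntegral R (f ^ 2) := by
  rw [ballIntegral_sq_reflAvg hu]
  have : 0 ≤ ∫ x in Metric.ball 0 R, (f x - f (reflect u x)) ^ 2 :=
    integral_nonneg fun x => sq_nonneg _
  linarith

lemma isReflInvariantOn_of_ballIntegral_sq_le {R : ℝ} {f : C(E n, ℝ)}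
    (h : ∀ u, ‖u‖ = 1 → ballIntegral R (f ^ 2) ≤ ballIntegral R (reflAvg u f ^ 2)) :
    IsReflInvariantOn R f := by
  intro u hu
  have hr := continuous_reflect u
  have h0 : ∫ x in Metric.ball 0 R, (f x - f (reflect u x)) ^ 2 = 0 := by
    refine le_antisymm ?_ (integral_nonneg fun x => sq_nonneg _)
    linarith [h u hu, ballIntegral_sq_reflAvg hu R f]
  rw [setIntegral_eq_zero_iff_of_nonneg_ae (.of_forall fun x => sq_nonneg _)
    (integrableOn_ball R (by fun_prop))] at h0
  have hEq := Measure.eqOn_open_of_ae_eq h0 Metric.isOpen_ball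
    (Continuous.continuousOn (by fun_prop)) continuousOn_const
  intro x hx
  exact (sub_eq_zero.1 (pow_eq_zero_iff two_ne_zero |>.1 (hEq (mem_ball_zero_iff.2 hx)))).symm

lemma exists_greedy_seq (hn : 0 < n) (F : ℕ → C(E n, ℝ)) (R : ℕ → ℝ) :
    ∃ u : ℕ → E n, (∀ i, ‖u i‖ = 1) ∧ ∀ m v, ‖v‖ = 1 →
      ballIntegral (R m) (iterReflAvg u (m + 1) (F m) ^ 2) ≤
        ballIntegral (R m) (reflAvg v (iterReflAvg u m (F m)) ^ 2) + 1 / (m + 1) := by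
  have hstep : ∀ (m : ℕ) (T : C(E n, ℝ) →L[ℝ] C(E n, ℝ)), ∃ u : E n, ‖u‖ = 1 ∧ ∀ v, ‖v‖ = 1 →
      ballIntegral (R m) (reflAvg u (T (F m)) ^ 2) ≤
        ballIntegral (R m) (reflAvg v (T (F m)) ^ 2) + 1 / (m + 1) := by
    intro m T
    obtain ⟨u₀, hu₀⟩ := exists_norm_eq_one hn
    let S := (fun v => ballIntegral (R m) (reflAvg v (T (F m)) ^ 2)) '' {v | ‖v‖ = 1}
    have hS : BddBelow S := ⟨0, by rintro _ ⟨v, -, rfl⟩; exact integral_nonneg fun x => sq_nonneg _⟩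
    obtain ⟨_, ⟨u, hu, rfl⟩, hlt⟩ := exists_lt_of_csInf_lt (Set.Nonempty.image _ ⟨u₀, hu₀⟩)
      (lt_add_of_pos_right (sInf S) (Nat.one_div_pos_of_nat (n := m)))
    exact ⟨u, hu, fun v hv => hlt.le.trans (by gcongr; exact csInf_le hS ⟨v, hv, rfl⟩)⟩
  choose pick hpick using hstep
  let T : ℕ → C(E n, ℝ) →L[ℝ] C(E n, ℝ) :=
    Nat.rec (.id ℝ _) fun m S => (reflAvg (pick m S)).comp S
  have hT : ∀ m, iterReflAvg (fun i => pick i (T i)) m = T m := fun m => by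
    induction m with
    | zero => rfl
    | succ m ih => rw [iterReflAvg, ih]
  refine ⟨fun i => pick i (T i), fun i => (hpick i _).1, fun m v hv => ?_⟩
  rw [iterReflAvg, hT]
  exact (hpick m (T m)).2 v hv

include hu in
lemma exists_isReflInvariantOn_tendsto {f : C(E n, ℝ)} {R : ℝ} {ν : ℕ → ℕ} (hν : StrictMono ν)
    (h : ∀ j v, ‖v‖ = 1 → ballIntegral R (iterReflAvg u (ν j + 1) f ^ 2) ≤
      ballIntegral R (reflAvg v (iterReflAvg u (ν j) f) ^ 2) + 1 / ((ν j : ℕ) + 1)) :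
    ∃ g : C(E n, ℝ), IsReflInvariantOn R g ∧
      ∃ φ : ℕ → ℕ, Tendsto (fun j => iterReflAvg u (φ j) f) atTop (𝓝 g) := by
  obtain ⟨g, -, φ, hφ, hg⟩ := (isCompact_closure_range_iterReflAvg hu f).tendsto_subseq
    fun j => subset_closure (Set.mem_range_self (ν j))
  refine ⟨g, isReflInvariantOn_of_ballIntegral_sq_le fun v hv => ?_, _, hg⟩
  have henergy : Continuous fun f : C(E n, ℝ) => ballIntegral R (f ^ 2) :=
    (continuous_ballIntegral R).comp (continuous_pow 2)
  have hanti : Antitone fun m => ballIntegral R (iterReflAvg u m f ^ 2) :=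
    antitone_nat_of_succ_le fun m => ballIntegral_sq_reflAvg_le (hu m) R _
  have hνφ : Tendsto (ν ∘ φ) atTop atTop := (hν.comp hφ).tendsto_atTop
  have hg_le : ∀ m, ballIntegral R (g ^ 2) ≤ ballIntegral R (iterReflAvg u m f ^ 2) := fun m =>
    le_of_tendsto ((henergy.tendsto g).comp hg)
      ((hνφ.eventually_ge_atTop m).mono fun j hj => hanti hj)
  have hlim : Tendsto (fun j => ballIntegral R (reflAvg v (iterReflAvg u (ν (φ j)) f) ^ 2) +
      1 / ((ν (φ j) : ℕ) + 1 : ℝ)) atTop (𝓝 (ballIntegral R (reflAvg v g ^ 2) + 0)) :=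
    (((henergy.comp (reflAvg v).continuous).tendsto g).comp hg).add
      (tendsto_one_div_add_atTop_nhds_zero_nat.comp hνφ)
  rw [add_zero] at hlim
  exact ge_of_tendsto' hlim fun j => (hg_le _).trans (h (φ j) v hv)

lemma exists_seq_approx_isReflInvariantOn (hn : 0 < n) :
    ∃ u : ℕ → E n, (∀ i, ‖u i‖ = 1) ∧ ∀ (f : C(E n, ℝ)) (R : ℝ), ∀ ε > 0,
      ∃ m, ∃ g : E n → ℝ, IsReflInvariantOn R g ∧
        ∀ x, ‖x‖ < R → |iterReflAvg u m f x - g x| ≤ ε := by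
  let F := TopologicalSpace.denseSeq C(E n, ℝ)
  obtain ⟨u, hu, hgreedy⟩ := exists_greedy_seq hn (fun m => F (m.unpair.1.unpair.1))
    fun m => m.unpair.1.unpair.2
  refine ⟨u, hu, fun f R ε hε => ?_⟩
  obtain ⟨N, hN⟩ := exists_nat_gt R
  obtain ⟨i, hi⟩ : ∃ i, ∀ x, ‖x‖ < R → |F i x - f x| < ε / 2 :=
    have hnear := tendsto_continuousMap_iff.1 tendsto_id R (ε / 2) (half_pos hε)
    (TopologicalSpace.denseRange_denseSeq C(E n, ℝ)).mem_nhds hnear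
  obtain ⟨g, hg, φ, hφ⟩ := exists_isReflInvariantOn_tendsto hu (f := F i) (R := N)
    (ν := fun j => Nat.pair (Nat.pair i N) j) (fun j k hjk => Nat.pair_lt_pair_right _ hjk)
    fun j v hv => by simpa using hgreedy (Nat.pair (Nat.pair i N) j) v hv
  obtain ⟨j, hj⟩ := (tendsto_continuousMap_iff.1 hφ N (ε / 2) (half_pos hε)).exists
  refine ⟨φ j, g, fun v hv x hx => hg v hv x (hx.trans hN), fun x hx => ?_⟩
  have hcontr : |iterReflAvg u (φ j) (f - F i) x| ≤ ε / 2 :=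
    abs_iterReflAvg_le hu (fun y hy => by
      rw [ContinuousMap.sub_apply, abs_sub_comm]; exact (hi y hy).le) (φ j) x hx
  rw [map_sub, ContinuousMap.sub_apply] at hcontr
  linarith [abs_sub_le (iterReflAvg u (φ j) f x) (iterReflAvg u (φ j) (F i) x) (g x),
    hj x (hx.trans hN)]

lemma isReflInvariantOn_of_approx {g : E n → ℝ} {R : ℝ}
    (h : ∀ ε > 0, ∃ p : E n → ℝ, IsReflInvariantOn R p ∧ ∀ x, ‖x‖ < R → |g x - p x| ≤ ε) :
    IsReflInvariantOn R g := by
  intro v hv x hx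
  refine eq_of_forall_dist_le fun ε hε => ?_
  obtain ⟨p, hp, hgp⟩ := h (ε / 2) (half_pos hε)
  have h1 := hgp x hx
  have h2 := hgp (reflect v x) (by rwa [norm_reflect hv])
  rw [hp v hv x hx] at h2
  rw [abs_sub_comm] at h1
  rw [Real.dist_eq]
  linarith [abs_sub_le (g (reflect v x)) (p x) (g x)]

/-- The successive averages of every continuous function over the reflections `R_{u i}` converge
locally uniformly to a radial function. -/
def IsSymmetrizing (u : ℕ → E n) : Prop :=
  ∀ f : C(E n, ℝ), ∃ g : C(E n, ℝ),
    (∀ x y, ‖x‖ = ‖y‖ → g x = g y) ∧ Tendsto (fun m => iterReflAvg u m f) atTop (𝓝 g)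

theorem exists_isSymmetrizing (hn : 0 < n) :
    ∃ u : ℕ → E n, (∀ i, ‖u i‖ = 1) ∧ IsSymmetrizing u := by
  obtain ⟨u, hu, happrox⟩ := exists_seq_approx_isReflInvariantOn hn
  refine ⟨u, hu, fun f => ?_⟩
  obtain ⟨g, -, φ, hφ, hg⟩ := (isCompact_closure_range_iterReflAvg hu f).tendsto_subseq
    fun m => subset_closure (Set.mem_range_self m)
  have hinv : ∀ R, IsReflInvariantOn R g := by
    refine fun R => isReflInvariantOn_of_approx fun ε hε => ?_
    obtain ⟨m, p, hp, hmp⟩ := happrox f R (ε / 2) (half_pos hε)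
    refine ⟨p, hp, fun x hx => ?_⟩
    obtain ⟨j, hmj, hj⟩ := ((hφ.tendsto_atTop.eventually_ge_atTop m).and
      (tendsto_continuousMap_iff.1 hg R (ε / 2) (half_pos hε))).exists
    have hgx : |iterReflAvg u (φ j) f x - g x| < ε / 2 := hj x hx
    rw [abs_sub_comm] at hgx
    linarith [abs_sub_le (g x) (iterReflAvg u (φ j) f x) (p x),
      abs_iterReflAvg_sub_le hu hp hmp hmj x hx]
  refine ⟨g, fun x y hxy => ?_, tendsto_continuousMap_iff.2 fun R ε hε => ?_⟩
  · rcases eq_or_ne x y with rfl | hne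
    · rfl
    obtain ⟨v, hv, rfl⟩ := exists_reflect_eq hxy hne
    exact (hinv _ v hv x (lt_add_one _)).symm
  · obtain ⟨j, hj⟩ := (tendsto_continuousMap_iff.1 hg R (ε / 2) (half_pos hε)).exists
    filter_upwards [eventually_ge_atTop (φ j)] with m hm x hx
    linarith [abs_iterReflAvg_sub_le hu (hinv R) (fun y hy => (hj y hy).le) hm x hx]

end Averages

section Symmetral

variable {n : ℕ} {u : E n} {ψ : E n → EReal}

lemma exists_eq_coe {a : EReal} (hbot : a ≠ ⊥) (htop : a ≠ ⊤) : ∃ p : ℝ, a = p :=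
  ⟨a.toReal, (EReal.coe_toReal htop hbot).symm⟩

lemma half_add_half_coe (p q : ℝ) :
    ((1 / 2 : ℝ) : EReal) * p + ((1 / 2 : ℝ) : EReal) * q = (((p + q) / 2 : ℝ) : EReal) := by
  rw [← EReal.coe_mul, ← EReal.coe_mul, ← EReal.coe_add]
  congr 1
  ring

lemma half_add_half_mono {a b c d : EReal} (hac : a ≤ c) (hbd : b ≤ d) :
    ((1 / 2 : ℝ) : EReal) * a + ((1 / 2 : ℝ) : EReal) * b ≤
      ((1 / 2 : ℝ) : EReal) * c + ((1 / 2 : ℝ) : EReal) * d := by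
  have h : (0 : EReal) ≤ ((1 / 2 : ℝ) : EReal) := EReal.coe_nonneg.2 (by norm_num)
  exact add_le_add (mul_le_mul_of_nonneg_left hac h) (mul_le_mul_of_nonneg_left hbd h)

lemma half_add_half_eq_top {a b : EReal} (ha : a ≠ ⊥) (hb : b ≠ ⊥) (h : a = ⊤ ∨ b = ⊤) :
    ((1 / 2 : ℝ) : EReal) * a + ((1 / 2 : ℝ) : EReal) * b = ⊤ := by
  have hmul : ((1 / 2 : ℝ) : EReal) * ⊤ = ⊤ := EReal.coe_mul_top_of_pos (by norm_num)
  have hne : ∀ c : EReal, c ≠ ⊥ → ((1 / 2 : ℝ) : EReal) * c ≠ ⊥ := by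
    intro c hc
    induction c with
    | bot => exact absurd rfl hc
    | top => rw [hmul]; exact top_ne_bot
    | coe c => exact EReal.coe_ne_bot (1 / 2 * c)
  rcases h with rfl | rfl
  · rw [hmul, EReal.top_add_of_ne_bot (hne b hb)]
  · rw [hmul, EReal.add_top_of_ne_bot (hne a ha)]

lemma exists_coe_of_half_add_half_lt {a b t : EReal} (ha : a ≠ ⊥) (hb : b ≠ ⊥)
    (h : ((1 / 2 : ℝ) : EReal) * a + ((1 / 2 : ℝ) : EReal) * b < t) :
    ∃ p q : ℝ, a = p ∧ b = q ∧ (((p + q) / 2 : ℝ) : EReal) < t := by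
  have htop : ¬ (a = ⊤ ∨ b = ⊤) := fun h' => not_top_lt (half_add_half_eq_top ha hb h' ▸ h)
  rw [not_or] at htop
  obtain ⟨p, rfl⟩ := exists_eq_coe ha htop.1
  obtain ⟨q, rfl⟩ := exists_eq_coe hb htop.2
  exact ⟨p, q, rfl, rfl, half_add_half_coe p q ▸ h⟩

lemma half_add_half_le {a b c : EReal}
    (h : ∀ p q : ℝ, (p : EReal) < a → (q : EReal) < b → (((p + q) / 2 : ℝ) : EReal) ≤ c) :
    ((1 / 2 : ℝ) : EReal) * a + ((1 / 2 : ℝ) : EReal) * b ≤ c := by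
  have hlt : ∀ (r : ℝ) (d : EReal), (r : EReal) < ((1 / 2 : ℝ) : EReal) * d →
      ((2 * r : ℝ) : EReal) < d := by
    intro r d hr
    induction d with
    | bot => rw [EReal.coe_mul_bot_of_pos (by norm_num)] at hr; exact absurd hr not_lt_bot
    | top => exact EReal.coe_lt_top _
    | coe d =>
      rw [← EReal.coe_mul, EReal.coe_lt_coe_iff] at hr
      exact EReal.coe_lt_coe_iff.2 (by linarith)
  refine EReal.add_le_of_forall_lt fun a' ha' b' hb' => ?_
  obtain ⟨r, har, hra⟩ := EReal.lt_iff_exists_real_btwn.1 ha'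
  obtain ⟨s, hbs, hsb⟩ := EReal.lt_iff_exists_real_btwn.1 hb'
  refine (add_le_add har.le hbs.le).trans ?_
  rw [← EReal.coe_add, show r + s = (2 * r + 2 * s) / 2 by ring]
  exact h _ _ (hlt r a hra) (hlt s b hsb)

lemma symmetral_apply (u : E n) (ψ : E n → EReal) (x : E n) :
    symmetral u ψ x = ⨅ y : E n, ((1 / 2 : ℝ) : EReal) * ψ ((2 : ℝ) • y) +
      ((1 / 2 : ℝ) : EReal) * ψ (reflect u ((2 : ℝ) • (x - y))) := by
  simp [symmetral, infConv, epiMul, reflectFun]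

lemma symmetral_le (hu : ‖u‖ = 1) {a b : E n} {p q : ℝ} (ha : ψ a ≤ p) (hb : ψ b ≤ q) :
    symmetral u ψ ((1 / 2 : ℝ) • (a + reflect u b)) ≤ (((p + q) / 2 : ℝ) : EReal) := by
  have hfst : (2 : ℝ) • ((1 / 2 : ℝ) • a) = a := by module
  have hsnd : (2 : ℝ) • ((1 / 2 : ℝ) • (a + reflect u b) - (1 / 2 : ℝ) • a) = reflect u b := by
    module
  rw [symmetral_apply]
  refine (iInf_le _ ((1 / 2 : ℝ) • a)).trans ?_
  rw [hfst, hsnd, reflect_reflect hu, ← half_add_half_coe]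
  exact half_add_half_mono ha hb

lemma exists_of_symmetral_lt (hu : ‖u‖ = 1) (hψ : ∀ x, ψ x ≠ ⊥) {x : E n} {t : EReal}
    (h : symmetral u ψ x < t) :
    ∃ (a b : E n) (p q : ℝ), ψ a = p ∧ ψ b = q ∧ x = (1 / 2 : ℝ) • (a + reflect u b) ∧
      (((p + q) / 2 : ℝ) : EReal) < t := by
  rw [symmetral_apply, iInf_lt_iff] at h
  obtain ⟨y, hy⟩ := h
  obtain ⟨p, q, hp, hq, hpq⟩ := exists_coe_of_half_add_half_lt (hψ _) (hψ _) hy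
  refine ⟨_, _, p, q, hp, hq, ?_, hpq⟩
  rw [reflect_reflect hu]
  module

/-- Proper convex functions which are bounded below: the class in which the Minkowski symmetrals of
a member of `Conv_c(ℝⁿ)` stay for formal reasons. -/
structure IsBddConvex (ψ : E n → EReal) : Prop where
  convex : Convex ℝ {p : E n × ℝ | ψ p.1 ≤ (p.2 : EReal)}
  bddBelow : ∃ c : ℝ, ∀ x, (c : EReal) ≤ ψ x
  dom_nonempty : ∃ x, ψ x ≠ ⊤

lemma ne_bot_of_coe_le {a : EReal} {c : ℝ} (h : (c : EReal) ≤ a) : a ≠ ⊥ :=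
  ((EReal.bot_lt_coe c).trans_le h).ne'

lemma IsBddConvex.ne_bot (h : IsBddConvex ψ) (x : E n) : ψ x ≠ ⊥ := by
  obtain ⟨c, hc⟩ := h.bddBelow
  exact ne_bot_of_coe_le (hc x)

lemma IsBddConvex.exists_eq_coe (h : IsBddConvex ψ) : ∃ (x : E n) (p : ℝ), ψ x = p := by
  obtain ⟨x, hx⟩ := h.dom_nonempty
  exact ⟨x, MinkSymm.exists_eq_coe (h.ne_bot x) hx⟩

lemma le_of_convex_epigraph (h : Convex ℝ {p : E n × ℝ | ψ p.1 ≤ (p.2 : EReal)})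
    {a b : E n} {p q s t : ℝ} (ha : ψ a ≤ p) (hb : ψ b ≤ q) (hs : 0 ≤ s) (ht : 0 ≤ t)
    (hst : s + t = 1) : ψ (s • a + t • b) ≤ ((s * p + t * q : ℝ) : EReal) :=
  h (x := (a, p)) ha (y := (b, q)) hb hs ht hst

lemma convex_epigraph_of_lt
    (h : ∀ (a b : E n) (p q s t : ℝ), ψ a < p → ψ b < q → 0 ≤ s → 0 ≤ t → s + t = 1 →
      ψ (s • a + t • b) ≤ ((s * p + t * q : ℝ) : EReal)) :
    Convex ℝ {p : E n × ℝ | ψ p.1 ≤ (p.2 : EReal)} := by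
  rintro ⟨a, p⟩ ha ⟨b, q⟩ hb s t hs ht hst
  rw [Set.mem_ofPred_eq] at ha hb
  change ψ (s • a + t • b) ≤ ((s * p + t * q : ℝ) : EReal)
  refine EReal.le_of_forall_lt_iff_le.1 fun z hz => ?_
  obtain ⟨ε, hε, rfl⟩ : ∃ ε > 0, z = s * p + t * q + ε :=
    ⟨z - (s * p + t * q), sub_pos.2 (EReal.coe_lt_coe_iff.1 hz), by ring⟩
  have hlt : ∀ r : ℝ, (r : EReal) < ((r + ε : ℝ) : EReal) := fun r =>
    EReal.coe_lt_coe_iff.2 (lt_add_of_pos_right r hε)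
  have hsum : s * (p + ε) + t * (q + ε) = s * p + t * q + ε := by
    linear_combination ε * hst
  exact hsum ▸ h a b _ _ s t (ha.trans_lt (hlt p)) (hb.trans_lt (hlt q)) hs ht hst

lemma le_symmetral (hu : ‖u‖ = 1) {c : ℝ} (hc : ∀ x, (c : EReal) ≤ ψ x) (x : E n) :
    (c : EReal) ≤ symmetral u ψ x := by
  by_contra! hlt
  obtain ⟨a, b, p, q, ha, hb, -, hpq⟩ :=
    exists_of_symmetral_lt hu (fun x => ne_bot_of_coe_le (hc x)) hlt
  have hcp : c ≤ p := EReal.coe_le_coe_iff.1 (ha ▸ hc a)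
  have hcq : c ≤ q := EReal.coe_le_coe_iff.1 (hb ▸ hc b)
  linarith [EReal.coe_lt_coe_iff.1 hpq]

lemma convex_epigraph_symmetral (hu : ‖u‖ = 1) (hbot : ∀ x, ψ x ≠ ⊥)
    (h : Convex ℝ {p : E n × ℝ | ψ p.1 ≤ (p.2 : EReal)}) :
    Convex ℝ {p : E n × ℝ | symmetral u ψ p.1 ≤ (p.2 : EReal)} := by
  refine convex_epigraph_of_lt fun a b p q s t ha hb hs ht hst => ?_
  obtain ⟨a₁, a₂, p₁, p₂, ha₁, ha₂, rfl, hp⟩ := exists_of_symmetral_lt hu hbot ha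
  obtain ⟨b₁, b₂, q₁, q₂, hb₁, hb₂, rfl, hq⟩ := exists_of_symmetral_lt hu hbot hb
  have hle := symmetral_le hu (le_of_convex_epigraph h ha₁.le hb₁.le hs ht hst)
    (le_of_convex_epigraph h ha₂.le hb₂.le hs ht hst)
  have hpoint : (1 / 2 : ℝ) • (s • a₁ + t • b₁ + reflect u (s • a₂ + t • b₂)) =
      s • (1 / 2 : ℝ) • (a₁ + reflect u a₂) + t • (1 / 2 : ℝ) • (b₁ + reflect u b₂) := by
    rw [reflect_add, reflect_smul, reflect_smul]
    module
  rw [hpoint] at hle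
  refine hle.trans (EReal.coe_le_coe_iff.2 ?_)
  rw [EReal.coe_lt_coe_iff] at hp hq
  linarith [mul_le_mul_of_nonneg_left hp.le hs, mul_le_mul_of_nonneg_left hq.le ht]

lemma IsBddConvex.symmetral (hu : ‖u‖ = 1) (h : IsBddConvex ψ) : IsBddConvex (symmetral u ψ) where
  convex := convex_epigraph_symmetral hu h.ne_bot h.convex
  bddBelow := h.bddBelow.imp fun _ hc => le_symmetral hu hc
  dom_nonempty := by
    obtain ⟨x, p, hp⟩ := h.exists_eq_coe
    exact ⟨_, ((symmetral_le hu hp.le hp.le).trans_lt (EReal.coe_lt_top _)).ne⟩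

lemma IsBddConvex.iterSymmetral {u : ℕ → E n} (hu : ∀ i, ‖u i‖ = 1) (h : IsBddConvex ψ) (m : ℕ) :
    IsBddConvex (iterSymmetral u ψ m) := by
  induction m with
  | zero => exact h
  | succ m ih => exact ih.symmetral (hu m)

lemma le_iterSymmetral {u : ℕ → E n} (hu : ∀ i, ‖u i‖ = 1) {c : ℝ} (hc : ∀ x, (c : EReal) ≤ ψ x)
    (m : ℕ) (x : E n) : (c : EReal) ≤ iterSymmetral u ψ m x := by
  induction m generalizing x with
  | zero => exact hc x
  | succ m ih => exact le_symmetral (hu m) ih x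

lemma IsConvC.exists_forall_le (h : IsConvC ψ) : ∃ x₀, ∀ x, ψ x₀ ≤ ψ x := by
  obtain ⟨x₁, hx₁⟩ := h.dom_nonempty
  obtain ⟨K, hK, hKψ⟩ := mem_cocompact.1
    (h.coercive.eventually (lt_mem_nhds (lt_top_iff_ne_top.2 hx₁)))
  have hmem : ∀ x, ψ x ≤ ψ x₁ → x ∈ K := fun x hx => by
    by_contra hxK
    exact absurd (hKψ hxK) (not_lt.2 hx)
  obtain ⟨x₀, -, hmin⟩ := LowerSemicontinuousOn.exists_isMinOn ⟨x₁, hmem x₁ le_rfl⟩ hK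
    (h.lsc.lowerSemicontinuousOn K)
  refine ⟨x₀, fun x => ?_⟩
  rcases le_or_gt (ψ x) (ψ x₁) with hx | hx
  · exact hmin (hmem x hx)
  · exact (hmin (hmem x₁ le_rfl)).trans hx.le

lemma IsConvC.isBddConvex (h : IsConvC ψ) : IsBddConvex ψ where
  convex := h.convex
  bddBelow := by
    obtain ⟨x₀, hx₀⟩ := h.exists_forall_le
    obtain ⟨x₁, hx₁⟩ := h.dom_nonempty
    obtain ⟨c, hc⟩ := exists_eq_coe (h.ne_bot x₀) (ne_top_of_le_ne_top hx₁ (hx₀ x₁))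
    exact ⟨c, fun x => hc ▸ hx₀ x⟩
  dom_nonempty := h.dom_nonempty

lemma add_norm_div_le_of_lt_outside_ball (h : IsBddConvex ψ) {x₀ : E n} {a R : ℝ} (hR : 0 < R)
    (ha : ψ x₀ ≤ a) (hout : ∀ x, R ≤ ‖x - x₀‖ → ((a + 1 : ℝ) : EReal) < ψ x) {x : E n}
    (hx : R ≤ ‖x - x₀‖) : ((a + ‖x - x₀‖ / R : ℝ) : EReal) ≤ ψ x := by
  by_contra! hlt
  obtain ⟨p, hp⟩ := exists_eq_coe (h.ne_bot x) (hlt.trans (EReal.coe_lt_top _)).ne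
  rw [hp, EReal.coe_lt_coe_iff] at hlt
  have hd : 0 < ‖x - x₀‖ := hR.trans_le hx
  -- the point of the segment `[x₀, x]` at distance `R` from `x₀`
  set t := R / ‖x - x₀‖ with ht
  have ht0 : 0 < t := div_pos hR hd
  have hle := le_of_convex_epigraph h.convex ha hp.le (sub_nonneg.2 ((div_le_one hd).2 hx)) ht0.le
    (sub_add_cancel 1 t)
  have hdist : ‖(1 - t) • x₀ + t • x - x₀‖ = R := by
    rw [show (1 - t) • x₀ + t • x - x₀ = t • (x - x₀) by module, norm_smul,
      Real.norm_of_nonneg ht0.le, ht, div_mul_cancel₀ _ hd.ne']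
  have hgt := EReal.coe_lt_coe_iff.1 ((hout _ hdist.ge).trans_le hle)
  have hcontra : t * (p - a) < 1 := by
    calc t * (p - a) < t * (‖x - x₀‖ / R) := by gcongr; linarith
      _ = 1 := by rw [ht]; field_simp
  linarith

lemma IsConvC.exists_linear_growth (h : IsConvC ψ) :
    ∃ ρ C : ℝ, 0 < ρ ∧ ∀ x, ((ρ * ‖x‖ - C : ℝ) : EReal) ≤ ψ x := by
  obtain ⟨c, hc⟩ := h.isBddConvex.bddBelow
  obtain ⟨x₀, a, ha⟩ := h.isBddConvex.exists_eq_coe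
  obtain ⟨K, hK, hKψ⟩ := mem_cocompact.1
    (h.coercive.eventually (lt_mem_nhds (EReal.coe_lt_top (a + 1))))
  obtain ⟨R, hR0, hR⟩ := hK.isBounded.subset_ball_lt 0 x₀
  have hout : ∀ x, R ≤ ‖x - x₀‖ → ((a + 1 : ℝ) : EReal) < ψ x := fun x hx =>
    hKψ fun hxK => hx.not_gt (mem_ball_iff_norm.1 (hR hxK))
  refine ⟨1 / R, ‖x₀‖ / R - min a (c - 1), by positivity, fun x => ?_⟩
  have htri : 1 / R * ‖x‖ ≤ ‖x - x₀‖ / R + ‖x₀‖ / R := by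
    rw [← add_div, one_div_mul_eq_div]
    gcongr
    exact norm_le_norm_sub_add x x₀
  rcases le_or_gt R ‖x - x₀‖ with hx | hx
  · refine le_trans (EReal.coe_le_coe_iff.2 ?_)
      (add_norm_div_le_of_lt_outside_ball h.isBddConvex hR0 ha.le hout hx)
    linarith [min_le_left a (c - 1)]
  · refine le_trans (EReal.coe_le_coe_iff.2 ?_) (hc x)
    linarith [(div_le_one hR0).2 hx.le, min_le_right a (c - 1)]

end Symmetral

section Conjugate

variable {n : ℕ} {ψ : E n → EReal} {y z : E n}

/-- The Legendre conjugate. -/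
noncomputable def conj (ψ : E n → EReal) (y : E n) : EReal :=
  ⨆ x : E n, ((inner ℝ x y : ℝ) : EReal) - ψ x

lemma conj_le_iff {c : ℝ} :
    conj ψ y ≤ (c : EReal) ↔ ∀ x, ((inner ℝ x y - c : ℝ) : EReal) ≤ ψ x := by
  rw [conj, iSup_le_iff]
  refine forall_congr' fun x => ?_
  generalize ψ x = a
  induction a with
  | bot => simp [-EReal.coe_sub]
  | top => simp
  | coe a => rw [← EReal.coe_sub, EReal.coe_le_coe_iff, EReal.coe_le_coe_iff, sub_le_comm]

lemma coe_lt_conj_iff {c : ℝ} :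
    (c : EReal) < conj ψ y ↔ ∃ x, ψ x < ((inner ℝ x y - c : ℝ) : EReal) := by
  rw [← not_le, conj_le_iff]
  push Not
  rfl

lemma coe_sub_le_conj {x : E n} {p : ℝ} (hp : ψ x ≤ p) :
    ((inner ℝ x y - p : ℝ) : EReal) ≤ conj ψ y := by
  rw [EReal.coe_sub]
  exact (EReal.sub_le_sub le_rfl hp).trans
    (le_iSup (fun x : E n => ((inner ℝ x y : ℝ) : EReal) - ψ x) x)

lemma IsBddConvex.conj_ne_bot (h : IsBddConvex ψ) (y : E n) : conj ψ y ≠ ⊥ := by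
  obtain ⟨x, p, hp⟩ := h.exists_eq_coe
  exact ne_bot_of_coe_le (coe_sub_le_conj hp.le)

lemma conj_zero_le {c : ℝ} (hc : ∀ x, (c : EReal) ≤ ψ x) : conj ψ 0 ≤ ((-c : ℝ) : EReal) :=
  conj_le_iff.2 fun x => by simpa [-EReal.coe_neg] using hc x

lemma conj_smul_add_smul_le {p q s t : ℝ} (hy : conj ψ y ≤ p) (hz : conj ψ z ≤ q) (hs : 0 ≤ s)
    (ht : 0 ≤ t) (hst : s + t = 1) : conj ψ (s • y + t • z) ≤ ((s * p + t * q : ℝ) : EReal) := by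
  rw [conj_le_iff] at *
  intro x
  have hmax : inner ℝ x (s • y + t • z) - (s * p + t * q) ≤
      max (inner ℝ x y - p) (inner ℝ x z - q) := by
    calc _ = s * (inner ℝ x y - p) + t * (inner ℝ x z - q) := by
          rw [inner_add_right, real_inner_smul_right, real_inner_smul_right]; ring
      _ ≤ _ := Convex.combo_le_max _ _ hs ht hst
  refine (EReal.coe_le_coe_iff.2 hmax).trans ?_
  rw [EReal.coe_strictMono.monotone.map_max]
  exact max_le (hy x) (hz x)

lemma conj_symmetral {u : E n} (hu : ‖u‖ = 1) (hψ : ∀ x, ψ x ≠ ⊥) (y : E n) :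
    conj (symmetral u ψ) y =
      ((1 / 2 : ℝ) : EReal) * conj ψ y + ((1 / 2 : ℝ) : EReal) * conj ψ (reflect u y) := by
  have hinner : ∀ a b : E n, inner ℝ ((1 / 2 : ℝ) • (a + reflect u b)) y =
      (inner ℝ a y + inner ℝ b (reflect u y)) / 2 := fun a b => by
    rw [real_inner_smul_left, inner_add_left, inner_reflect_left]
    ring
  refine le_antisymm ?_ (half_add_half_le fun p q hp hq => ?_)
  · refine EReal.ge_of_forall_gt_iff_ge.1 fun c hc => ?_
    obtain ⟨x, hx⟩ := coe_lt_conj_iff.1 hc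
    obtain ⟨a, b, p, q, ha, hb, rfl, hpq⟩ := exists_of_symmetral_lt hu hψ hx
    refine le_trans ?_ (half_add_half_mono (coe_sub_le_conj ha.le) (coe_sub_le_conj hb.le))
    rw [half_add_half_coe, EReal.coe_le_coe_iff]
    rw [hinner, EReal.coe_lt_coe_iff] at hpq
    linarith
  · obtain ⟨a, ha⟩ := coe_lt_conj_iff.1 hp
    obtain ⟨b, hb⟩ := coe_lt_conj_iff.1 hq
    refine le_trans (le_of_eq ?_) (coe_sub_le_conj (symmetral_le hu ha.le hb.le))
    rw [hinner]
    congr 1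
    ring

end Conjugate

section EpiConvergence

variable {n : ℕ} {ψ : E n → EReal}

lemma exists_affine_between (h : IsBddConvex ψ) {k : E n → ℝ} (hk : ConcaveOn ℝ Set.univ k)
    (hkc : Continuous k) (hle : ∀ z, (k z : EReal) ≤ ψ z) :
    ∃ (y : E n) (c : ℝ), (∀ z, k z ≤ inner ℝ z y - c) ∧ conj ψ y ≤ c := by
  have hdisj : Disjoint {p : E n × ℝ | p.1 ∈ Set.univ ∧ p.2 < k p.1}
      {p | ψ p.1 ≤ (p.2 : EReal)} := Set.disjoint_left.2 fun p hp hp' =>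
    hp.2.not_ge (EReal.coe_le_coe_iff.1 ((hle p.1).trans hp'))
  have hopen : IsOpen {p : E n × ℝ | p.1 ∈ Set.univ ∧ p.2 < k p.1} := by
    simpa using isOpen_lt continuous_snd (hkc.comp continuous_fst)
  obtain ⟨f, v, hlt, hge⟩ := geometric_hahn_banach_open hk.convex_strict_hypograph hopen h.convex
    hdisj
  set β : ℝ := f (0, 1)
  have hf : ∀ z τ, f (z, τ) = f (z, 0) + β * τ := fun z τ => by
    rw [show (z, τ) = (z, (0 : ℝ)) + τ • ((0 : E n), (1 : ℝ)) by simp, map_add, map_smul,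
      smul_eq_mul, mul_comm τ]
  have hbelow : ∀ z, ∀ τ < k z, f (z, 0) + β * τ < v := fun z τ hτ =>
    hf z τ ▸ hlt (z, τ) ⟨trivial, hτ⟩
  have habove : ∀ z (τ : ℝ), ψ z ≤ τ → v ≤ f (z, 0) + β * τ := fun z τ hτ => hf z τ ▸ hge (z, τ) hτ
  have hβ : 0 < β := by
    obtain ⟨z, r, hr⟩ := h.exists_eq_coe
    have hkr : k z ≤ r := EReal.coe_le_coe_iff.1 (hr ▸ hle z)
    have := hbelow z (k z - 1) (by linarith)
    have := habove z r hr.le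
    exact pos_of_mul_pos_left (b := r - (k z - 1)) (by linarith) (by linarith)
  have hgraph : ∀ z, f (z, 0) + β * k z ≤ v := fun z =>
    le_of_tendsto (x := 𝓝[<] k z)
      ((by fun_prop : Continuous fun τ => f (z, 0) + β * τ).continuousWithinAt)
      (eventually_mem_nhdsWithin.mono fun τ hτ => (hbelow z τ hτ).le)
  let w := (InnerProductSpace.toDual ℝ (E n)).symm (f.comp (.inl ℝ (E n) ℝ))
  have hw : ∀ z, inner ℝ z ((-β⁻¹) • w) = -f (z, 0) / β := fun z => by
    rw [real_inner_smul_right, real_inner_comm, InnerProductSpace.toDual_symm_apply, neg_mul,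
      neg_div, div_eq_inv_mul]
    rfl
  refine ⟨(-β⁻¹) • w, -v / β, fun z => ?_, conj_le_iff.2 fun z => ?_⟩
  · rw [hw, ← sub_div, le_div_iff₀ hβ]
    linarith [hgraph z]
  · rw [hw, ← sub_div]
    refine EReal.le_of_forall_lt_iff_le.1 fun r hr => EReal.coe_le_coe_iff.2 ?_
    rw [div_le_iff₀ hβ]
    linarith [habove z r hr.le]

lemma concaveOn_const_sub_mul_norm_sub {t s : ℝ} (hs : 0 ≤ s) (x : E n) :
    ConcaveOn ℝ Set.univ fun z => t - s * ‖z - x‖ := by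
  have hnorm : ConvexOn ℝ Set.univ fun z : E n => ‖z - x‖ := by
    simpa [dist_eq_norm] using convexOn_univ_dist x
  exact (concaveOn_const t convex_univ).sub (hnorm.smul hs)

lemma norm_le_of_const_sub_mul_norm_sub_le_inner {x y : E n} {s t c : ℝ} (hs : 0 ≤ s)
    (h : ∀ z, t - s * ‖z - x‖ ≤ inner ℝ z y - c) : ‖y‖ ≤ s := by
  by_contra! hlt
  have hgap : 0 < ‖y‖ * (‖y‖ - s) := mul_pos (hs.trans_lt hlt) (sub_pos.2 hlt)
  obtain ⟨k, hk⟩ := exists_nat_gt ((inner ℝ x y - c - t) / (‖y‖ * (‖y‖ - s)))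
  rw [div_lt_iff₀ hgap] at hk
  have := h (x - (k : ℝ) • y)
  rw [inner_sub_left, real_inner_smul_left, real_inner_self_eq_norm_sq, sub_sub_cancel_left,
    norm_neg, norm_smul, Real.norm_of_nonneg k.cast_nonneg] at this
  linarith

lemma exists_norm_le_conj_le (h : IsBddConvex ψ) {x : E n} {s t : ℝ} (hs : 0 ≤ s)
    (hst : ∀ z, ((t - s * ‖z - x‖ : ℝ) : EReal) ≤ ψ z) :
    ∃ y : E n, ‖y‖ ≤ s ∧ conj ψ y ≤ ((inner ℝ x y - t : ℝ) : EReal) := by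
  obtain ⟨y, c, hy, hc⟩ := exists_affine_between h (concaveOn_const_sub_mul_norm_sub hs x)
    (by fun_prop) hst
  refine ⟨y, norm_le_of_const_sub_mul_norm_sub_le_inner hs hy, hc.trans (EReal.coe_le_coe_iff.2 ?_)⟩
  have := hy x
  rw [sub_self, norm_zero] at this
  linarith

lemma coe_sub_mul_norm_sub_le {x : E n} {a c ε : ℝ} (hε : 0 < ε) (hc : ∀ z, (c : EReal) ≤ ψ z)
    (ha : ∀ z, ‖z - x‖ < ε → (a : EReal) ≤ ψ z) (z : E n) :
    ((a - max 0 ((a - c) / ε) * ‖z - x‖ : ℝ) : EReal) ≤ ψ z := by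
  rcases lt_or_ge ‖z - x‖ ε with hz | hz
  · exact (EReal.coe_le_coe_iff.2 (sub_le_self a (by positivity))).trans (ha z hz)
  · refine (EReal.coe_le_coe_iff.2 ?_).trans (hc z)
    have : a - c ≤ max 0 ((a - c) / ε) * ‖z - x‖ := by
      calc a - c = (a - c) / ε * ε := by field_simp
        _ ≤ _ := mul_le_mul (le_max_right _ _) hz hε.le (le_max_left _ _)
    linarith

/-- The supremum of the affine functions `⟨·, y⟩ - h y` over the slopes `y ∈ U`: the Legendre
conjugate of the function which is `h` on `U` and `+∞` off `U`. -/
noncomputable def conjOn (U : Set (E n)) (h : E n → ℝ) (x : E n) : EReal :=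
  ⨆ y : U, ((inner ℝ x y.1 - h y : ℝ) : EReal)

variable {U : Set (E n)} {h : E n → ℝ}

lemma le_conjOn {y : E n} (hy : y ∈ U) (x : E n) :
    ((inner ℝ x y - h y : ℝ) : EReal) ≤ conjOn U h x :=
  le_iSup (fun y : U => ((inner ℝ x y.1 - h y : ℝ) : EReal)) ⟨y, hy⟩

lemma tendsto_conjOn_cocompact {ρ C : ℝ} (hρ : 0 < ρ) (hρU : Metric.closedBall 0 ρ ⊆ U)
    (hC : ∀ y ∈ Metric.closedBall 0 ρ, h y ≤ C) :
    Tendsto (conjOn U h) (cocompact (E n)) (𝓝 ⊤) := by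
  rw [EReal.tendsto_nhds_top_iff_real]
  intro M
  filter_upwards [(tendsto_norm_cocompact_atTop (E := E n)).eventually_gt_atTop
    (max 0 ((M + C) / ρ))] with x hx
  obtain ⟨hx0, hxM⟩ := max_lt_iff.1 hx
  rw [div_lt_iff₀ hρ] at hxM
  have hy : (ρ / ‖x‖) • x ∈ Metric.closedBall 0 ρ := by
    rw [mem_closedBall_zero_iff, norm_smul, Real.norm_of_nonneg (by positivity),
      div_mul_cancel₀ _ hx0.ne']
  have hinner : inner ℝ x ((ρ / ‖x‖) • x) = ρ * ‖x‖ := by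
    rw [real_inner_smul_right, real_inner_self_eq_norm_sq]
    field_simp
  refine lt_of_lt_of_le (EReal.coe_lt_coe_iff.2 ?_) (le_conjOn (hρU hy) x)
  linarith [hC _ hy]

lemma isConvC_conjOn {ρ C : ℝ} (hρ : 0 < ρ) (hρU : Metric.closedBall 0 ρ ⊆ U)
    (hC : ∀ y ∈ Metric.closedBall 0 ρ, h y ≤ C) (hmin : ∀ y ∈ U, h 0 ≤ h y) :
    IsConvC (conjOn U h) where
  convex := by
    refine convex_epigraph_of_lt fun a b p q s t ha hb hs ht hst => iSup_le fun y => ?_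
    have hay := EReal.coe_le_coe_iff.1 ((le_conjOn y.2 a).trans ha.le)
    have hby := EReal.coe_le_coe_iff.1 ((le_conjOn y.2 b).trans hb.le)
    rw [EReal.coe_le_coe_iff, inner_add_left, real_inner_smul_left, real_inner_smul_left]
    linear_combination s * hay + t * hby + h y * hst
  ne_bot x := ne_bot_of_coe_le (le_conjOn (hρU (Metric.mem_closedBall_self hρ.le)) x)
  dom_nonempty := by
    refine ⟨0, ne_top_of_le_ne_top (EReal.coe_ne_top (-h 0)) (iSup_le fun y => ?_)⟩
    rw [EReal.coe_le_coe_iff, inner_zero_left]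
    linarith [hmin y y.2]
  lsc := lowerSemicontinuous_iSup fun y =>
    (continuous_coe_real_ereal.comp (by fun_prop)).lowerSemicontinuous
  coercive := tendsto_conjOn_cocompact hρ hρU hC

lemma rotationInvariant_conjOn (hU : ∀ y ∈ U, ∀ z, ‖z‖ = ‖y‖ → z ∈ U ∧ h z = h y) :
    RotationInvariant (conjOn U h) := by
  have hle : ∀ (T : E n ≃ₗᵢ[ℝ] E n) (x : E n), conjOn U h (T x) ≤ conjOn U h x := by
    refine fun T x => iSup_le fun y => ?_
    obtain ⟨hmem, heq⟩ := hU y y.2 (T.symm y) (T.symm.norm_map y)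
    have := le_conjOn (h := h) hmem x
    rwa [heq, ← T.inner_map_map, T.apply_symm_apply] at this
  refine fun T x => le_antisymm (hle T x) ?_
  simpa using hle T.symm (T x)

variable {ψs : ℕ → E n → EReal}

lemma conjOn_le_liminf
    (hlim : ∀ y ∈ U, Tendsto (fun m => conj (ψs m) y) atTop (𝓝 (h y : EReal)))
    {x : E n} {xs : ℕ → E n} (hxs : Tendsto xs atTop (𝓝 x)) :
    conjOn U h x ≤ liminf (fun m => ψs m (xs m)) atTop := by
  refine iSup_le fun ⟨y, hy⟩ => EReal.ge_of_forall_gt_iff_ge.1 fun a ha => ?_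
  rw [EReal.coe_lt_coe_iff] at ha
  obtain ⟨b, hab, hb⟩ := exists_between (lt_sub_comm.1 ha)
  have hinner : Tendsto (fun m => (inner ℝ (xs m) y : ℝ)) atTop (𝓝 (inner ℝ x y)) :=
    hxs.inner tendsto_const_nhds
  refine le_liminf_of_le (by isBoundedDefault) ?_
  filter_upwards [(hlim y hy).eventually_lt_const (EReal.coe_lt_coe_iff.2 hab),
    hinner.eventually_const_lt (show b + a < inner ℝ x y by linarith)] with m hconj hm
  exact (EReal.coe_le_coe_iff.2 (by linarith)).trans (conj_le_iff.1 hconj.le (xs m))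

lemma exists_seq_forall_eventually {α : Type*} [Nonempty α] {P : ℝ → ℕ → α → Prop}
    (hmono : ∀ ⦃ε ε' : ℝ⦄, ε ≤ ε' → ∀ m z, P ε m z → P ε' m z)
    (h : ∀ ε > 0, ∀ᶠ m in atTop, ∃ z, P ε m z) :
    ∃ zs : ℕ → α, ∀ ε > 0, ∀ᶠ m in atTop, P ε m (zs m) := by
  classical
  let Q : ℕ → ℕ → Prop := fun m k => ∃ z, P (1 / (k + 1)) m z
  -- at time `m`, use the smallest tolerance `1 / (k + 1)` with `k ≤ m` that can be met
  let k : ℕ → ℕ := fun m => Nat.findGreatest (Q m) m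
  refine ⟨fun m => Classical.epsilon (P (1 / (k m + 1)) m), fun ε hε => ?_⟩
  obtain ⟨K, hK⟩ := exists_nat_one_div_lt hε
  filter_upwards [h (1 / (K + 1)) (by positivity), eventually_ge_atTop K] with m hm hKm
  have hkm : (K : ℝ) ≤ k m := by exact_mod_cast Nat.le_findGreatest (P := Q m) hKm hm
  refine hmono ?_ m _ (Classical.epsilon_spec (Nat.findGreatest_spec (P := Q m) hKm hm))
  exact (one_div_le_one_div_of_le (by positivity) (by gcongr)).trans hK.le

lemma tendsto_prodMk_const {α β γ : Type*} [TopologicalSpace β] {F : α × β → γ} {la : Filter α}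
    {lc : Filter γ} {b : β} (hF : Tendsto F (la ×ˢ 𝓝 b) lc) :
    Tendsto (fun a => F (a, b)) la lc :=
  hF.comp (tendsto_id.prodMk tendsto_const_nhds)

variable {c : ℝ} (hc : ∀ m x, (c : EReal) ≤ ψs m x)
  (hU : ∀ y ∈ U, Tendsto (fun p : ℕ × E n => conj (ψs p.1) p.2) (atTop ×ˢ 𝓝 y) (𝓝 (h y : EReal)))
  (hout : ∀ y, ∀ θ ∈ Set.Ioo (0 : ℝ) 1, θ • y ∉ U →
    ∀ᶠ p : ℕ × E n in atTop ×ˢ 𝓝 y, conj (ψs p.1) p.2 = ⊤)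

include hc hU hout

lemma coe_le_conjOn_of_tendsto {x y : E n} {t : ℝ} {k : ℕ → ℕ} {ys : ℕ → E n}
    (hk : Tendsto k atTop atTop) (hys : Tendsto ys atTop (𝓝 y))
    (hle : ∀ j, conj (ψs (k j)) (ys j) ≤ ((inner ℝ x (ys j) - t : ℝ) : EReal)) :
    (t : EReal) ≤ conjOn U h x := by
  have hθ : ∀ θ ∈ Set.Ioo (0 : ℝ) 1, ((θ * t + (1 - θ) * c : ℝ) : EReal) ≤ conjOn U h x := by
    intro θ hθ
    have hmem : θ • y ∈ U := by
      by_contra hnot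
      obtain ⟨j, hj⟩ := ((hk.prodMk hys).eventually (hout y θ hθ hnot)).exists
      exact EReal.coe_ne_top _ (top_le_iff.1 (hj ▸ hle j))
    have hconv : ∀ j, conj (ψs (k j)) (θ • ys j) ≤
        ((θ * (inner ℝ x (ys j) - t) + (1 - θ) * -c : ℝ) : EReal) := fun j => by
      simpa using conj_smul_add_smul_le (hle j) (conj_zero_le (hc (k j))) hθ.1.le
        (sub_nonneg.2 hθ.2.le) (add_sub_cancel θ 1)
    have hlim : Tendsto (fun j => ((θ * (inner ℝ x (ys j) - t) + (1 - θ) * -c : ℝ) : EReal)) atTop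
        (𝓝 ((θ * (inner ℝ x y - t) + (1 - θ) * -c : ℝ) : EReal)) :=
      EReal.tendsto_coe.2 ((((tendsto_const_nhds.inner hys).sub_const t).const_mul θ).add_const _)
    have hbound := le_of_tendsto_of_tendsto'
      ((hU _ hmem).comp (hk.prodMk (hys.const_smul θ))) hlim hconv
    refine (EReal.coe_le_coe_iff.2 ?_).trans (le_conjOn hmem x)
    rw [EReal.coe_le_coe_iff] at hbound
    rw [real_inner_smul_right]
    linarith
  have hone : Tendsto (fun θ : ℝ => ((θ * t + (1 - θ) * c : ℝ) : EReal)) (𝓝[<] 1) (𝓝 t) :=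
    ((continuous_coe_real_ereal.comp (by fun_prop)).tendsto' _ _ (by simp)).mono_left inf_le_left
  exact le_of_tendsto hone (by filter_upwards [Ioo_mem_nhdsLT one_pos] with θ using hθ θ)

lemma eventually_exists_le_of_conjOn_le (hψ : ∀ m, IsBddConvex (ψs m)) {x : E n} {a ε : ℝ}
    (ha : conjOn U h x ≤ a) (hε : 0 < ε) :
    ∀ᶠ m in atTop, ∃ z, ‖z - x‖ < ε ∧ ψs m z ≤ ((a + ε : ℝ) : EReal) := by
  by_contra hnot
  rw [not_eventually] at hnot
  obtain ⟨φ, hφ, hbad⟩ := extraction_of_frequently_atTop hnot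
  push Not at hbad
  have hslope := fun j => exists_norm_le_conj_le (hψ (φ j)) (le_max_left 0 ((a + ε - c) / ε))
    (coe_sub_mul_norm_sub_le hε (hc (φ j)) fun z hz => (hbad j z hz).le)
  choose ys hys hconj using hslope
  obtain ⟨y, -, ν, hν, hy⟩ := (isCompact_closedBall (0 : E n) _).tendsto_subseq
    fun j => mem_closedBall_zero_iff.2 (hys j)
  have := (coe_le_conjOn_of_tendsto hc hU hout (hφ.comp hν).tendsto_atTop hy
    fun j => hconj (ν j)).trans ha
  linarith [EReal.coe_le_coe_iff.1 this]

theorem epiConverges_conjOn (hψ : ∀ m, IsBddConvex (ψs m)) (h0 : 0 ∈ U) :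
    EpiConverges ψs (conjOn U h) := by
  have hlim : ∀ y ∈ U, Tendsto (fun m => conj (ψs m) y) atTop (𝓝 (h y : EReal)) :=
    fun y hy => tendsto_prodMk_const (hU y hy)
  refine fun x => ⟨fun xs => conjOn_le_liminf hlim, ?_⟩
  rcases eq_or_ne (conjOn U h x) ⊤ with htop | htop
  · refine ⟨fun _ => x, tendsto_const_nhds, ?_⟩
    have := conjOn_le_liminf hlim (tendsto_const_nhds (x := x))
    rw [htop] at this ⊢
    exact tendsto_of_le_liminf_of_limsup_le this le_top
  obtain ⟨a, ha⟩ := exists_eq_coe (ne_bot_of_coe_le (le_conjOn h0 x)) htop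
  obtain ⟨xs, hxs⟩ := exists_seq_forall_eventually
    (fun ε ε' hεε' m z hz => ⟨hz.1.trans_le hεε', hz.2.trans (EReal.coe_le_coe_iff.2 (by gcongr))⟩)
    fun ε hε => eventually_exists_le_of_conjOn_le hc hU hout hψ ha.le hε
  have hxs_tendsto : Tendsto xs atTop (𝓝 x) := Metric.tendsto_nhds.2 fun ε hε =>
    (hxs ε hε).mono fun m hm => (dist_eq_norm _ x).trans_lt hm.1
  refine ⟨xs, hxs_tendsto,
    tendsto_of_le_liminf_of_limsup_le (conjOn_le_liminf hlim hxs_tendsto) ?_⟩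
  rw [ha]
  refine EReal.le_of_forall_lt_iff_le.1 fun b hb => limsup_le_of_le (by isBoundedDefault) ?_
  filter_upwards [hxs (b - a) (sub_pos.2 (EReal.coe_lt_coe_iff.1 hb))] with m hm
  simpa only [add_sub_cancel] using hm.2

end EpiConvergence

section ConjugateSymmetral

variable {n : ℕ} {ψ : E n → EReal} {u : ℕ → E n}

lemma IsConvC.exists_conj_le (h : IsConvC ψ) :
    ∃ ρ C : ℝ, 0 < ρ ∧ ∀ y, ‖y‖ ≤ ρ → conj ψ y ≤ C := by
  obtain ⟨ρ, C, hρ, hψ⟩ := h.exists_linear_growth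
  refine ⟨ρ, C, hρ, fun y hy => conj_le_iff.2 fun x => (EReal.coe_le_coe_iff.2 ?_).trans (hψ x)⟩
  have : inner ℝ x y ≤ ρ * ‖x‖ := by
    calc inner ℝ x y ≤ ‖x‖ * ‖y‖ := real_inner_le_norm x y
      _ ≤ ρ * ‖x‖ := by rw [mul_comm]; gcongr
  linarith

lemma convex_conj_ne_top (h : IsBddConvex ψ) : Convex ℝ {y | conj ψ y ≠ ⊤} := by
  intro y hy z hz s t hs ht hst
  obtain ⟨p, hp⟩ := exists_eq_coe (h.conj_ne_bot y) hy
  obtain ⟨q, hq⟩ := exists_eq_coe (h.conj_ne_bot z) hz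
  exact ne_top_of_le_ne_top (EReal.coe_ne_top _) (conj_smul_add_smul_le hp.le hq.le hs ht hst)

lemma continuousOn_toReal_conj (h : IsBddConvex ψ) {ρ : ℝ} (hρ : ∀ y, ‖y‖ < ρ → conj ψ y ≠ ⊤) :
    ContinuousOn (fun y => (conj ψ y).toReal) (Metric.ball 0 ρ) := by
  have hcoe : ∀ y ∈ Metric.ball (0 : E n) ρ, conj ψ y = ((conj ψ y).toReal : EReal) := fun y hy =>
    (EReal.coe_toReal (hρ y (mem_ball_zero_iff.1 hy)) (h.conj_ne_bot y)).symm
  refine ConvexOn.continuousOn Metric.isOpen_ball ⟨convex_ball 0 ρ, ?_⟩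
  intro y hy z hz s t hs ht hst
  have hle := conj_smul_add_smul_le (hcoe y hy).le (hcoe z hz).le hs ht hst
  rwa [hcoe _ (convex_ball 0 ρ hy hz hs ht hst), EReal.coe_le_coe_iff] at hle

lemma exists_continuousMap_eq_conj (h : IsBddConvex ψ) {q ρ : ℝ} (hq : q < ρ)
    (hρ : ∀ y, ‖y‖ < ρ → conj ψ y ≠ ⊤) :
    ∃ f : C(E n, ℝ), ∀ y, ‖y‖ < q → conj ψ y = (f y : EReal) := by
  have hcont : ContinuousOn (fun y => (conj ψ y).toReal) (Metric.closedBall 0 q) :=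
    (continuousOn_toReal_conj h hρ).mono (Metric.closedBall_subset_ball hq)
  obtain ⟨f, hf⟩ := ContinuousMap.exists_restrict_eq Metric.isClosed_closedBall
    ⟨_, hcont.domRestrict⟩
  refine ⟨f, fun y hy => ?_⟩
  have hfy : f y = (conj ψ y).toReal :=
    DFunLike.congr_fun hf (⟨y, mem_closedBall_zero_iff.2 hy.le⟩ : Metric.closedBall (0 : E n) q)
  rw [hfy, EReal.coe_toReal (hρ y (hy.trans hq)) (h.conj_ne_bot y)]

lemma IsConvC.exists_continuousMap_pos_of_conj_eq_top (h : IsConvC ψ) {z : E n} {q : ℝ}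
    (hz : conj ψ z = ⊤) (hzq : ‖z‖ < q) :
    ∃ f : C(E n, ℝ), (∀ y, 0 ≤ f y) ∧ (∀ y, 0 < f y → conj ψ y = ⊤) ∧ ∃ y, ‖y‖ < q ∧ 0 < f y := by
  set D := {y | conj ψ y ≠ ⊤}
  obtain ⟨ρ, C, hρ, hC⟩ := h.exists_conj_le
  have hball : Metric.ball 0 ρ ⊆ D := fun y hy =>
    ne_top_of_le_ne_top (EReal.coe_ne_top C) (hC y (mem_ball_zero_iff.1 hy).le)
  have hD0 : (0 : E n) ∈ interior D :=
    mem_interior.2 ⟨_, hball, Metric.isOpen_ball, Metric.mem_ball_self hρ⟩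
  refine ⟨⟨fun y => Metric.infDist y D, Metric.continuous_infDist_pt D⟩,
    fun y => Metric.infDist_nonneg, fun y hy => ?_, ?_⟩
  · by_contra hyD
    exact hy.ne' (Metric.infDist_zero_of_mem hyD)
  -- otherwise `D` is dense in the ball, hence contains it, being convex with nonempty interior
  by_contra! hnot
  have hsub : Metric.ball 0 q ⊆ closure D := fun y hy =>
    (Metric.mem_closure_iff_infDist_zero ⟨0, interior_subset hD0⟩).2
      ((hnot y (mem_ball_zero_iff.1 hy)).antisymm Metric.infDist_nonneg)
  have hint := interior_maximal hsub Metric.isOpen_ball (mem_ball_zero_iff.2 hzq)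
  rw [(convex_conj_ne_top h.isBddConvex).interior_closure_eq_interior_of_nonempty_interior
    ⟨0, hD0⟩] at hint
  exact interior_subset hint hz

lemma conj_eq_top_of_forall_norm_eq (h : IsBddConvex ψ) {r : ℝ}
    (hr : ∀ y : E n, ‖y‖ = r → conj ψ y = ⊤) {y : E n} (hr0 : 0 ≤ r) (hy : r ≤ ‖y‖) :
    conj ψ y = ⊤ := by
  by_contra hne
  obtain ⟨c, hc⟩ := h.bddBelow
  have h0 : conj ψ 0 ≠ ⊤ := ne_top_of_le_ne_top (EReal.coe_ne_top _) (conj_zero_le hc)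
  have hnorm : ‖(r / ‖y‖) • y‖ = r := by
    rw [norm_smul, Real.norm_of_nonneg (by positivity)]
    exact div_mul_cancel_of_imp fun h' => hr0.antisymm' (h' ▸ hy)
  refine convex_conj_ne_top h |>.starConvex h0 |>.smul_mem hne (t := r / ‖y‖) (by positivity)
    (div_le_one_of_le₀ hy (norm_nonneg y)) (hr _ hnorm)

variable (hu : ∀ i, ‖u i‖ = 1)

include hu

lemma conj_iterSymmetral_succ (h : IsBddConvex ψ) (m : ℕ) (y : E n) :
    conj (iterSymmetral u ψ (m + 1)) y =
      ((1 / 2 : ℝ) : EReal) * conj (iterSymmetral u ψ m) y +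
        ((1 / 2 : ℝ) : EReal) * conj (iterSymmetral u ψ m) (reflect (u m) y) :=
  conj_symmetral (hu m) (h.iterSymmetral hu m).ne_bot y

lemma conj_iterSymmetral_eq_iterReflAvg (h : IsBddConvex ψ) {f : C(E n, ℝ)} {q : ℝ}
    (hf : ∀ y, ‖y‖ < q → conj ψ y = (f y : EReal)) (m : ℕ) :
    ∀ y, ‖y‖ < q → conj (iterSymmetral u ψ m) y = (iterReflAvg u m f y : EReal) := by
  induction m with
  | zero => exact hf
  | succ m ih =>
    intro y hy
    rw [conj_iterSymmetral_succ hu h, ih y hy, ih _ ((norm_reflect (hu m) y).trans_lt hy),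
      half_add_half_coe, iterReflAvg_succ_apply]

lemma conj_iterSymmetral_le (h : IsBddConvex ψ) {ρ C : ℝ} (hC : ∀ y, ‖y‖ ≤ ρ → conj ψ y ≤ C)
    (m : ℕ) : ∀ y, ‖y‖ ≤ ρ → conj (iterSymmetral u ψ m) y ≤ C := by
  induction m with
  | zero => exact hC
  | succ m ih =>
    intro y hy
    rw [conj_iterSymmetral_succ hu h]
    refine (half_add_half_mono (ih y hy) (ih _ ((norm_reflect (hu m) y).trans_le hy))).trans ?_
    rw [half_add_half_coe, add_self_div_two]

lemma conj_iterSymmetral_eq_top_of_pos (h : IsBddConvex ψ) {f : C(E n, ℝ)}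
    (hf : ∀ y, 0 < f y → conj ψ y = ⊤) (m : ℕ) :
    ∀ y, 0 < iterReflAvg u m f y → conj (iterSymmetral u ψ m) y = ⊤ := by
  induction m with
  | zero => exact hf
  | succ m ih =>
    intro y hy
    have hm := h.iterSymmetral hu m
    rw [conj_iterSymmetral_succ hu h]
    refine half_add_half_eq_top (hm.conj_ne_bot _) (hm.conj_ne_bot _) ?_
    rw [iterReflAvg_succ_apply] at hy
    rcases lt_or_ge 0 (iterReflAvg u m f y) with hpos | hneg
    · exact .inl (ih _ hpos)
    · exact .inr (ih _ (by linarith))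

lemma exists_pos_of_tendsto_iterReflAvg {f g : C(E n, ℝ)} (hf : ∀ x, 0 ≤ f x) {R : ℝ} {y : E n}
    (hy : ‖y‖ < R) (hpos : 0 < f y) (hg : Tendsto (fun m => iterReflAvg u m f) atTop (𝓝 g)) :
    ∃ x, ‖x‖ < R ∧ 0 < g x := by
  have heq : ballIntegral R g = ballIntegral R f := tendsto_nhds_unique
    (((continuous_ballIntegral R).tendsto g).comp hg)
    (tendsto_const_nhds.congr fun m => (ballIntegral_iterReflAvg hu R f m).symm)
  by_contra! hnot
  refine (ballIntegral_pos hf hy hpos).not_ge (heq ▸ ?_)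
  exact MeasureTheory.setIntegral_nonpos Metric.isOpen_ball.measurableSet
    fun x hx => hnot x (mem_ball_zero_iff.1 hx)

lemma IsConvC.eventually_conj_iterSymmetral_eq_top (hsymm : IsSymmetrizing u)
    (h : IsConvC ψ) {z : E n} {q : ℝ} (hz : conj ψ z = ⊤) (hzq : ‖z‖ < q) :
    ∀ᶠ m in atTop, ∀ y, q ≤ ‖y‖ → conj (iterSymmetral u ψ m) y = ⊤ := by
  obtain ⟨f, hf0, hftop, y, hyq, hfy⟩ := h.exists_continuousMap_pos_of_conj_eq_top hz hzq
  obtain ⟨g, hrad, hg⟩ := hsymm f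
  obtain ⟨x, hxq, hgx⟩ := exists_pos_of_tendsto_iterReflAvg hu hf0 hyq hfy hg
  filter_upwards [tendsto_continuousMap_iff.1 hg q (g x) hgx] with m hm y hy
  refine conj_eq_top_of_forall_norm_eq (h.isBddConvex.iterSymmetral hu m) (fun w hw => ?_)
    (norm_nonneg x) (hxq.le.trans hy)
  refine conj_iterSymmetral_eq_top_of_pos hu h.isBddConvex hftop m w ?_
  have := (abs_lt.1 (hm w (hw.trans_lt hxq))).1
  rw [hrad w x hw] at this
  linarith

lemma exists_tendsto_conj_iterSymmetral (hsymm : IsSymmetrizing u) (h : IsBddConvex ψ)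
    {y : E n} {ρ : ℝ} (hy : ‖y‖ < ρ) (hρ : ∀ z, ‖z‖ < ρ → conj ψ z ≠ ⊤) :
    ∃ r : ℝ, ∀ z, ‖z‖ = ‖y‖ → Tendsto (fun p : ℕ × E n => conj (iterSymmetral u ψ p.1) p.2)
      (atTop ×ˢ 𝓝 z) (𝓝 (r : EReal)) := by
  obtain ⟨q, hyq, hqρ⟩ := exists_between hy
  obtain ⟨f, hf⟩ := exists_continuousMap_eq_conj h hqρ hρ
  obtain ⟨g, hrad, hg⟩ := hsymm f
  refine ⟨g y, fun z hz => ?_⟩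
  have hpair : Tendsto (fun p : ℕ × E n => (iterReflAvg u p.1 f, p.2)) (atTop ×ˢ 𝓝 z)
      (𝓝 (g, z)) := (hg.prodMap tendsto_id).mono_right (nhds_prod_eq (x := g) (y := z)).ge
  have hlim : Tendsto (fun p : ℕ × E n => iterReflAvg u p.1 f p.2) (atTop ×ˢ 𝓝 z) (𝓝 (g z)) :=
    (continuous_eval.tendsto (g, z)).comp hpair
  rw [← hrad z y hz]
  refine (EReal.tendsto_coe.2 hlim).congr' ?_
  filter_upwards [tendsto_snd.eventually
    ((continuous_norm.tendsto z).eventually_lt_const (hz.trans_lt hyq))] with p hp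
  exact (conj_iterSymmetral_eq_iterReflAvg hu h hf p.1 p.2 hp).symm

end ConjugateSymmetral

section EpiSymmetrization

variable {n : ℕ} {ψ : E n → EReal} {u : ℕ → E n}

/-- The largest open ball about the origin on which the conjugate of `ψ` is finite (possibly the
whole space). On it the conjugates of the successive symmetrals of `ψ` converge, and off its closure
they are eventually infinite. -/
def finiteBall (ψ : E n → EReal) : Set (E n) := {y | ∃ ρ > ‖y‖, ∀ z, ‖z‖ < ρ → conj ψ z ≠ ⊤}

lemma mem_finiteBall_of_norm_eq {y z : E n} (hy : y ∈ finiteBall ψ) (hz : ‖z‖ = ‖y‖) :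
    z ∈ finiteBall ψ := by
  obtain ⟨ρ, hρ, hfin⟩ := hy
  exact ⟨ρ, hz.trans_lt hρ, hfin⟩

lemma IsConvC.exists_closedBall_subset_finiteBall (h : IsConvC ψ) :
    ∃ ρ C : ℝ, 0 < ρ ∧ Metric.closedBall 0 ρ ⊆ finiteBall ψ ∧ ∀ y, ‖y‖ ≤ ρ → conj ψ y ≤ C := by
  obtain ⟨ρ, C, hρ, hC⟩ := h.exists_conj_le
  refine ⟨ρ / 2, C, half_pos hρ, fun y hy => ⟨ρ, ?_, fun z hz => ?_⟩,
    fun y hy => hC y (hy.trans (half_le_self hρ.le))⟩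
  · exact (mem_closedBall_zero_iff.1 hy).trans_lt (half_lt_self hρ)
  · exact ne_top_of_le_ne_top (EReal.coe_ne_top C) (hC z hz.le)

lemma conj_zero_le_of_le_of_le {y : E n} {r : ℝ} (hy : conj ψ y ≤ r)
    (hy' : conj ψ (-y) ≤ r) : conj ψ 0 ≤ r := by
  have hle := conj_smul_add_smul_le hy hy' (s := 1 / 2) (t := 1 / 2) (by norm_num) (by norm_num)
    (by norm_num)
  rwa [smul_neg, add_neg_cancel, ← add_mul, add_halves, one_mul] at hle

lemma limit_zero_le {l : E n → ℝ} {y : E n}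
    (h0 : Tendsto (fun m => conj (iterSymmetral u ψ m) 0) atTop (𝓝 (l 0 : EReal)))
    (hy : Tendsto (fun m => conj (iterSymmetral u ψ m) y) atTop (𝓝 (l y : EReal)))
    (hy' : Tendsto (fun m => conj (iterSymmetral u ψ m) (-y)) atTop (𝓝 (l y : EReal))) :
    l 0 ≤ l y := by
  refine le_of_forall_gt_imp_ge_of_dense fun r hr => EReal.coe_le_coe_iff.1 (le_of_tendsto h0 ?_)
  have hr' : (l y : EReal) < r := EReal.coe_lt_coe_iff.2 hr
  filter_upwards [hy.eventually_lt_const hr', hy'.eventually_lt_const hr'] with m hm hm'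
  exact conj_zero_le_of_le_of_le hm.le hm'.le

variable (hu : ∀ i, ‖u i‖ = 1) (hsymm : IsSymmetrizing u)

include hu hsymm

lemma exists_radial_tendsto_conj_iterSymmetral (h : IsBddConvex ψ) :
    ∃ l : E n → ℝ, (∀ y ∈ finiteBall ψ, ∀ z, ‖z‖ = ‖y‖ → l z = l y) ∧
      ∀ y ∈ finiteBall ψ, Tendsto (fun p : ℕ × E n => conj (iterSymmetral u ψ p.1) p.2)
        (atTop ×ˢ 𝓝 y) (𝓝 (l y : EReal)) := by
  have hlim : ∀ y, ∃ r : ℝ, y ∈ finiteBall ψ → ∀ z, ‖z‖ = ‖y‖ →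
      Tendsto (fun p : ℕ × E n => conj (iterSymmetral u ψ p.1) p.2) (atTop ×ˢ 𝓝 z)
        (𝓝 (r : EReal)) := by
    intro y
    by_cases hy : y ∈ finiteBall ψ
    · obtain ⟨ρ, hyρ, hρ⟩ := id hy
      exact (exists_tendsto_conj_iterSymmetral hu hsymm h hyρ hρ).imp fun r hr _ => hr
    · exact ⟨0, fun hy' => absurd hy' hy⟩
  choose l hl using hlim
  refine ⟨l, fun y hy z hz => ?_, fun y hy => hl y hy y rfl⟩
  exact EReal.coe_injective
    (tendsto_nhds_unique (hl z (mem_finiteBall_of_norm_eq hy hz) z rfl) (hl y hy z hz))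

lemma eventually_conj_iterSymmetral_eq_top_of_smul_notMem (h : IsConvC ψ) {y : E n} {θ : ℝ}
    (hθ : θ ∈ Set.Ioo (0 : ℝ) 1) (hy : θ • y ∉ finiteBall ψ) :
    ∀ᶠ p in atTop ×ˢ 𝓝 y, conj (iterSymmetral u ψ p.1) p.2 = ⊤ := by
  have hy0 : 0 < ‖y‖ := norm_pos_iff.2 fun h0 => hy <| by
    obtain ⟨ρ, -, hρ, hsub, -⟩ := h.exists_closedBall_subset_finiteBall
    rw [h0, smul_zero]
    exact hsub (Metric.mem_closedBall_self hρ.le)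
  have hlt : ‖θ • y‖ < ‖y‖ := by
    rw [norm_smul, Real.norm_of_nonneg hθ.1.le]
    exact mul_lt_of_lt_one_left hy0 hθ.2
  obtain ⟨q, hq, hqy⟩ := exists_between hlt
  obtain ⟨z, hzq, hz⟩ : ∃ z, ‖z‖ < q ∧ conj ψ z = ⊤ := by
    by_contra! hfin
    exact hy ⟨q, hq, hfin⟩
  filter_upwards [(h.eventually_conj_iterSymmetral_eq_top hu hsymm hz hzq).prod_mk
    ((continuous_norm.tendsto y).eventually_const_lt hqy)] with p hp
  exact hp.1 p.2 hp.2.le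

end EpiSymmetrization

theorem exists_epiSymmetrization {n : ℕ} (hn : 0 < n) {ψ : E n → EReal} (h : IsConvC ψ) :
    ∃ φ, IsEpiSymmetrization ψ φ := by
  obtain ⟨u, hu, hsymm⟩ := exists_isSymmetrizing hn
  obtain ⟨l, hrad, hl⟩ := exists_radial_tendsto_conj_iterSymmetral hu hsymm h.isBddConvex
  obtain ⟨ρ, C, hρ, hρU, hC⟩ := h.exists_closedBall_subset_finiteBall
  obtain ⟨c, hc⟩ := h.isBddConvex.bddBelow
  have h0 : (0 : E n) ∈ finiteBall ψ := hρU (Metric.mem_closedBall_self hρ.le)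
  have hpt : ∀ y ∈ finiteBall ψ,
      Tendsto (fun m => conj (iterSymmetral u ψ m) y) atTop (𝓝 (l y : EReal)) := fun y hy =>
    tendsto_prodMk_const (hl y hy)
  have hlC : ∀ y ∈ Metric.closedBall 0 ρ, l y ≤ C := fun y hy => EReal.coe_le_coe_iff.1 <|
    le_of_tendsto' (hpt y (hρU hy)) fun m =>
      conj_iterSymmetral_le hu h.isBddConvex hC m y (mem_closedBall_zero_iff.1 hy)
  have hmin : ∀ y ∈ finiteBall ψ, l 0 ≤ l y := fun y hy =>
    limit_zero_le (hpt 0 h0) (hpt y hy)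
      (hrad y hy (-y) (norm_neg y) ▸ hpt _ (mem_finiteBall_of_norm_eq hy (norm_neg y)))
  exact ⟨conjOn (finiteBall ψ) l, isConvC_conjOn hρ hρU hlC hmin,
    rotationInvariant_conjOn fun y hy z hz => ⟨mem_finiteBall_of_norm_eq hy hz, hrad y hy z hz⟩,
    u, hu, epiConverges_conjOn (fun m => le_iterSymmetral hu hc m) hl
      (fun y θ hθ hy => eventually_conj_iterSymmetral_eq_top_of_smul_notMem hu hsymm h hθ hy)
      (h.isBddConvex.iterSymmetral hu) h0⟩

section Scalar

/-- The decreasing change of scale `a ↦ (1 - α a)_+^{1/α}`, read as `e^{-a}` for `α = 0`, so that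
`ofBase α ψ = profile α ∘ ψ`. -/
noncomputable def profile (α : ℝ) (a : EReal) : ℝ :=
  open Classical in
  if a = ⊤ then 0
  else if α = 0 then Real.exp (-a.toReal)
  else (max (1 - α * a.toReal) 0) ^ (1 / α)

/-- The inverse of `profile α` on the positive numbers. -/
noncomputable def level (α v : ℝ) : ℝ := if α = 0 then -Real.log v else (1 - v ^ α) / α

/-- The strict lower bound of the values of base functions: on `(baseInf α, baseSup α)`, `profile α`
is finite, positive and invertible. -/
noncomputable def baseInf (α : ℝ) : EReal := if α < 0 then ((1 / α : ℝ) : EReal) else ⊥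

/-- The value from which on `profile α` vanishes. -/
noncomputable def baseSup (α : ℝ) : EReal := if 0 < α then ((1 / α : ℝ) : EReal) else ⊤

variable {α : ℝ}

lemma baseSup_of_pos (hα : 0 < α) : baseSup α = ((1 / α : ℝ) : EReal) := if_pos hα

lemma baseSup_of_nonpos (hα : α ≤ 0) : baseSup α = ⊤ := if_neg hα.not_gt

lemma exists_coe_of_mem_Ioo {a b c : EReal} (h : a ∈ Set.Ioo b c) : ∃ p : ℝ, a = p :=
  exists_eq_coe (bot_le.trans_lt h.1).ne' (h.2.trans_le le_top).ne

lemma mem_Ioo_baseInf_baseSup_iff {a : ℝ} :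
    (a : EReal) ∈ Set.Ioo (baseInf α) (baseSup α) ↔ 0 < 1 - α * a := by
  unfold baseInf baseSup
  rcases lt_trichotomy α 0 with hα | rfl | hα
  · rw [if_pos hα, if_neg hα.not_gt, Set.mem_Ioo, EReal.coe_lt_coe_iff, div_lt_iff_of_neg hα,
      and_iff_left (EReal.coe_lt_top a), sub_pos, mul_comm]
  · simp
  · rw [if_neg hα.not_gt, if_pos hα, Set.mem_Ioo, EReal.coe_lt_coe_iff, lt_div_iff₀ hα,
      and_iff_right (EReal.bot_lt_coe a), sub_pos, mul_comm]

lemma combo_mem_Ioo {a b s t : ℝ} (ha : (a : EReal) ∈ Set.Ioo (baseInf α) (baseSup α))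
    (hb : (b : EReal) ∈ Set.Ioo (baseInf α) (baseSup α)) (hs : 0 ≤ s) (ht : 0 ≤ t)
    (hst : s + t = 1) : ((s * a + t * b : ℝ) : EReal) ∈ Set.Ioo (baseInf α) (baseSup α) :=
  (Set.ordConnected_Ioo.preimage_mono EReal.coe_strictMono.monotone).convex ha hb hs ht hst

lemma combo_lt_baseSup {a b s t : ℝ} (ha : (a : EReal) ≤ baseSup α) (hb : (b : EReal) < baseSup α)
    (hs : 0 ≤ s) (ht : 0 < t) (hst : s + t = 1) :
    ((s * a + t * b : ℝ) : EReal) < baseSup α := by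
  rcases le_or_gt α 0 with hα | hα
  · exact baseSup_of_nonpos hα ▸ EReal.coe_lt_top _
  rw [baseSup_of_pos hα, EReal.coe_le_coe_iff] at ha
  rw [baseSup_of_pos hα, EReal.coe_lt_coe_iff] at hb ⊢
  calc s * a + t * b < s * (1 / α) + t * (1 / α) :=
        add_lt_add_of_le_of_lt (mul_le_mul_of_nonneg_left ha hs) (mul_lt_mul_of_pos_left hb ht)
    _ = 1 / α := by rw [← add_mul, hst, one_mul]

lemma half_lt_baseSup {a : ℝ} (ha : (a : EReal) ≤ baseSup α) :
    ((a / 2 : ℝ) : EReal) < baseSup α := by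
  have h0 : ((0 : ℝ) : EReal) < baseSup α := (mem_Ioo_baseInf_baseSup_iff.2 (by simp)).2
  convert combo_lt_baseSup ha h0 (s := 1 / 2) (t := 1 / 2) (by norm_num) (by norm_num)
    (by norm_num) using 2
  ring

lemma baseInf_lt_half {a : ℝ} (ha : baseInf α < a) : baseInf α < ((a / 2 : ℝ) : EReal) := by
  unfold baseInf at *
  split_ifs at * with hα
  · rw [EReal.coe_lt_coe_iff] at *
    linarith [one_div_neg.2 hα]
  · exact EReal.bot_lt_coe _

lemma profile_top : profile α ⊤ = 0 := if_pos rfl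

lemma profile_zero_coe (a : ℝ) : profile 0 (a : EReal) = Real.exp (-a) := by simp [profile]

lemma profile_coe (hα : α ≠ 0) (a : ℝ) :
    profile α (a : EReal) = (max (1 - α * a) 0) ^ (1 / α) := by simp [profile, hα]

lemma profile_coe_of_mem_Ioo (hα : α ≠ 0) {a : ℝ}
    (ha : (a : EReal) ∈ Set.Ioo (baseInf α) (baseSup α)) :
    profile α (a : EReal) = (1 - α * a) ^ (1 / α) := by
  rw [profile_coe hα, max_eq_left (mem_Ioo_baseInf_baseSup_iff.1 ha).le]

lemma profile_nonneg (a : EReal) : 0 ≤ profile α a := by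
  unfold profile
  split_ifs <;> positivity

lemma profile_pos {a : EReal} (ha : a ∈ Set.Ioo (baseInf α) (baseSup α)) : 0 < profile α a := by
  obtain ⟨p, rfl⟩ := exists_coe_of_mem_Ioo ha
  rcases eq_or_ne α 0 with rfl | hα
  · rw [profile_zero_coe]
    positivity
  · rw [profile_coe_of_mem_Ioo hα ha]
    exact Real.rpow_pos_of_pos (mem_Ioo_baseInf_baseSup_iff.1 ha) _

lemma profile_eq_zero {a : EReal} (ha : baseSup α ≤ a) : profile α a = 0 := by
  rcases eq_or_ne a ⊤ with rfl | htop
  · exact profile_top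
  rcases le_or_gt α 0 with hα | hα
  · exact absurd (top_le_iff.1 (baseSup_of_nonpos hα ▸ ha)) htop
  rw [baseSup_of_pos hα] at ha
  obtain ⟨p, rfl⟩ := exists_eq_coe (ne_bot_of_coe_le ha) htop
  rw [EReal.coe_le_coe_iff, div_le_iff₀ hα] at ha
  rw [profile_coe hα.ne', max_eq_right (by linarith), Real.zero_rpow (by positivity)]

lemma profile_ne_zero_iff {a : EReal} (ha : baseInf α < a) : profile α a ≠ 0 ↔ a < baseSup α :=
  ⟨fun h => not_le.1 fun h' => h (profile_eq_zero h'), fun h => (profile_pos ⟨ha, h⟩).ne'⟩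

lemma profile_le_profile {a b : EReal} (ha : baseInf α < a) (hab : a ≤ b) :
    profile α b ≤ profile α a := by
  rcases le_or_gt (baseSup α) b with hb | hb
  · exact profile_eq_zero hb ▸ profile_nonneg a
  have ha' : a ∈ Set.Ioo (baseInf α) (baseSup α) := ⟨ha, hab.trans_lt hb⟩
  have hb' : b ∈ Set.Ioo (baseInf α) (baseSup α) := ⟨ha.trans_le hab, hb⟩
  obtain ⟨p, rfl⟩ := exists_coe_of_mem_Ioo ha'
  obtain ⟨q, rfl⟩ := exists_coe_of_mem_Ioo hb'
  have hpq : p ≤ q := EReal.coe_le_coe_iff.1 hab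
  have hp := mem_Ioo_baseInf_baseSup_iff.1 ha'
  have hq := mem_Ioo_baseInf_baseSup_iff.1 hb'
  rcases lt_trichotomy α 0 with hα | rfl | hα
  · rw [profile_coe_of_mem_Ioo hα.ne ha', profile_coe_of_mem_Ioo hα.ne hb']
    refine Real.rpow_le_rpow_of_nonpos hp ?_ (one_div_nonpos.2 hα.le)
    linarith [mul_le_mul_of_nonpos_left hpq hα.le]
  · rw [profile_zero_coe, profile_zero_coe]
    gcongr
  · rw [profile_coe_of_mem_Ioo hα.ne' ha', profile_coe_of_mem_Ioo hα.ne' hb']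
    gcongr

lemma level_mem_Ioo {v : ℝ} (hv : 0 < v) :
    (level α v : EReal) ∈ Set.Ioo (baseInf α) (baseSup α) := by
  rw [mem_Ioo_baseInf_baseSup_iff]
  rcases eq_or_ne α 0 with rfl | hα
  · simp
  · rw [level, if_neg hα, mul_div_cancel₀ _ hα, sub_sub_cancel]
    exact Real.rpow_pos_of_pos hv α

lemma profile_level {v : ℝ} (hv : 0 < v) : profile α (level α v) = v := by
  rcases eq_or_ne α 0 with rfl | hα
  · rw [profile_zero_coe, level, if_pos rfl, neg_neg, Real.exp_log hv]
  · rw [profile_coe_of_mem_Ioo hα (level_mem_Ioo hv), level, if_neg hα,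
      mul_div_cancel₀ _ hα, sub_sub_cancel, one_div, Real.rpow_rpow_inv hv.le hα]

lemma level_profile {a : ℝ} (ha : (a : EReal) ∈ Set.Ioo (baseInf α) (baseSup α)) :
    level α (profile α a) = a := by
  rcases eq_or_ne α 0 with rfl | hα
  · rw [profile_zero_coe, level, if_pos rfl, Real.log_exp, neg_neg]
  · rw [profile_coe_of_mem_Ioo hα ha, level, if_neg hα, one_div,
      Real.rpow_inv_rpow (mem_Ioo_baseInf_baseSup_iff.1 ha).le hα, sub_sub_cancel,
      mul_div_cancel_left₀ _ hα]

lemma level_le_iff {v τ : ℝ} (hv : 0 < v) (hτ : baseInf α < τ) :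
    level α v ≤ τ ↔ profile α τ ≤ v := by
  refine ⟨fun h => ?_, fun h => ?_⟩
  · rw [← profile_level (α := α) hv]
    exact profile_le_profile (level_mem_Ioo hv).1 (EReal.coe_le_coe_iff.2 h)
  · by_contra! hlt
    have hlt' : (τ : EReal) < level α v := EReal.coe_lt_coe_iff.2 hlt
    have hge := profile_le_profile hτ hlt'.le
    rw [profile_level hv] at hge
    have heq := level_profile ⟨hτ, hlt'.trans (level_mem_Ioo hv).2⟩
    rw [le_antisymm h hge] at heq
    exact hlt.ne' heq

lemma continuousAt_profile_top : ContinuousAt (profile α) ⊤ := by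
  rw [ContinuousAt, profile_top, Metric.tendsto_nhds]
  intro ε hε
  filter_upwards [lt_mem_nhds (EReal.coe_lt_top (level α (ε / 2)))] with b hb
  have hle := profile_le_profile (level_mem_Ioo (half_pos hε)).1 hb.le
  rw [profile_level (half_pos hε)] at hle
  rw [Real.dist_eq, sub_zero, abs_of_nonneg (profile_nonneg b)]
  exact hle.trans_lt (half_lt_self hε)

lemma continuousAt_profile {a : EReal} (ha : baseInf α < a) : ContinuousAt (profile α) a := by
  rcases eq_or_ne a ⊤ with rfl | htop
  · exact continuousAt_profile_top
  obtain ⟨p, rfl⟩ := exists_eq_coe (bot_le.trans_lt ha).ne' htop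
  rw [ContinuousAt, EReal.nhds_coe, tendsto_map'_iff]
  rcases eq_or_ne α 0 with rfl | hα
  · simp only [Function.comp_def, profile_zero_coe]
    exact (by fun_prop : Continuous fun t : ℝ => Real.exp (-t)).tendsto p
  · simp only [Function.comp_def, profile_coe hα]
    refine ContinuousAt.rpow_const (f := fun t : ℝ => max (1 - α * t) 0) (by fun_prop) ?_
    rcases hα.lt_or_gt with hneg | hpos
    · have hmem : (p : EReal) ∈ Set.Ioo (baseInf α) (baseSup α) :=
        ⟨ha, baseSup_of_nonpos hneg.le ▸ EReal.coe_lt_top p⟩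
      exact .inl (lt_max_of_lt_left (mem_Ioo_baseInf_baseSup_iff.1 hmem)).ne'
    · exact .inr (by positivity)

lemma exists_lt_forall_profile_lt {a : EReal} (ha : baseInf α < a) {y : ℝ}
    (hy : profile α a < y) : ∃ s < a, ∀ t, s < t → profile α t < y := by
  obtain ⟨l, hl, hsub⟩ := exists_Ioc_subset_of_mem_nhds
    ((continuousAt_profile ha).eventually (gt_mem_nhds hy)) ⟨_, ha⟩
  obtain ⟨s, hs, hsa⟩ := exists_between (max_lt hl ha)
  have hsy : profile α s < y := hsub ⟨(le_max_left _ _).trans_lt hs, hsa.le⟩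
  exact ⟨s, hsa, fun t ht =>
    (profile_le_profile ((le_max_right _ _).trans_lt hs) ht.le).trans_lt hsy⟩

lemma alphaMean_profile {a b s t : ℝ} (ha : (a : EReal) ∈ Set.Ioo (baseInf α) (baseSup α))
    (hb : (b : EReal) ∈ Set.Ioo (baseInf α) (baseSup α)) (hs : 0 ≤ s) (ht : 0 ≤ t)
    (hst : s + t = 1) :
    alphaMean α s t (profile α a) (profile α b) = profile α ((s * a + t * b : ℝ) : EReal) := by
  rcases eq_or_ne α 0 with rfl | hα
  · rw [alphaMean, if_pos rfl, profile_zero_coe, profile_zero_coe, profile_zero_coe,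
      ← Real.exp_mul, ← Real.exp_mul, ← Real.exp_add]
    congr 1
    ring
  · rw [alphaMean, if_neg hα, profile_coe_of_mem_Ioo hα ha, profile_coe_of_mem_Ioo hα hb,
      profile_coe_of_mem_Ioo hα (combo_mem_Ioo ha hb hs ht hst), one_div,
      Real.rpow_inv_rpow (mem_Ioo_baseInf_baseSup_iff.1 ha).le hα,
      Real.rpow_inv_rpow (mem_Ioo_baseInf_baseSup_iff.1 hb).le hα]
    congr 1
    linear_combination hst

end Scalar

section Base

variable {n : ℕ} {α : ℝ} {f : E n → ℝ} {χ : E n → EReal}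

lemma ofBase_apply (α : ℝ) (χ : E n → EReal) (x : E n) : ofBase α χ x = profile α (χ x) := rfl

lemma support_ofBase (h : ∀ x, baseInf α < χ x) :
    Function.support (ofBase α χ) = {x | χ x < baseSup α} :=
  Set.ext fun x => profile_ne_zero_iff (h x)

lemma baseFn_of_pos {x : E n} (hx : 0 < f x) : baseFn α f x = level α (f x) := by
  unfold baseFn level
  rcases lt_trichotomy α 0 with hα | rfl | hα
  · rw [if_neg hα.not_gt, if_neg hx.ne', if_neg hα.ne, if_neg hα.ne]
  · rw [if_neg (lt_irrefl 0), if_neg hx.ne', if_pos rfl, if_pos rfl]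
  · rw [if_pos hα, if_pos (subset_closure hx.ne'), if_neg hα.ne']

lemma baseFn_of_mem_closure {x : E n} (hx : f x = 0) (hcl : x ∈ closure (Function.support f)) :
    baseFn α f x = baseSup α := by
  unfold baseFn baseSup
  split_ifs with hα
  · rw [hx, Real.zero_rpow hα.ne', sub_zero]
  · rfl

lemma baseFn_of_notMem_closure {x : E n} (hcl : x ∉ closure (Function.support f)) :
    baseFn α f x = ⊤ := by
  have hx : f x = 0 := by_contra fun h => hcl (subset_closure h)
  simp [baseFn, hx, hcl]

lemma baseSup_le_baseFn {x : E n} (hx : f x = 0) : baseSup α ≤ baseFn α f x := by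
  by_cases hcl : x ∈ closure (Function.support f)
  · exact (baseFn_of_mem_closure hx hcl).ge
  · exact baseFn_of_notMem_closure hcl ▸ le_top

/-- The functions which are recovered from `ofBase α` by `baseFn α`. The class contains the base
functions of members of `C_α(ℝⁿ)`, and is closed under Minkowski symmetrization. -/
structure IsBase (α : ℝ) (χ : E n → EReal) : Prop where
  convex : Convex ℝ {p : E n × ℝ | χ p.1 ≤ (p.2 : EReal)}
  lower : ∃ c : ℝ, baseInf α < c ∧ ∀ x, (c : EReal) ≤ χ x
  compact_dom : 0 < α → IsCompact {x | χ x ≠ ⊤}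
  le_baseSup : ∀ x, χ x ≠ ⊤ → χ x ≤ baseSup α
  exists_lt : ∃ x, χ x < baseSup α

lemma half_mul_coe (p : ℝ) :
    ((1 / 2 : ℝ) : EReal) * p = ((p / 2 : ℝ) : EReal) := by
  rw [← EReal.coe_mul, one_div_mul_eq_div]

lemma half_mul_eq_top_iff {a : EReal} : ((1 / 2 : ℝ) : EReal) * a = ⊤ ↔ a = ⊤ := by
  induction a with
  | bot => simp [EReal.coe_mul_bot_of_pos]
  | top => simp [EReal.coe_mul_top_of_pos]
  | coe a => rw [half_mul_coe]; simp only [EReal.coe_ne_top]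

lemma half_mul_le_coe_iff {a : EReal} {p : ℝ} :
    ((1 / 2 : ℝ) : EReal) * a ≤ p ↔ a ≤ ((2 * p : ℝ) : EReal) := by
  induction a with
  | bot => simp only [EReal.coe_mul_bot_of_pos one_half_pos, bot_le]
  | top => simp only [EReal.coe_mul_top_of_pos one_half_pos, top_le_iff, EReal.coe_ne_top]
  | coe a => rw [half_mul_coe, EReal.coe_le_coe_iff, EReal.coe_le_coe_iff, div_le_iff₀' two_pos]

namespace IsBase

lemma baseInf_lt (h : IsBase α χ) (x : E n) : baseInf α < χ x := by
  obtain ⟨c, hc, hcx⟩ := h.lower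
  exact hc.trans_le (hcx x)

lemma ne_bot (h : IsBase α χ) (x : E n) : χ x ≠ ⊥ := (bot_le.trans_lt (h.baseInf_lt x)).ne'

lemma mem_closure_support (h : IsBase α χ) {x : E n} (hx : χ x ≠ ⊤) :
    x ∈ closure (Function.support (ofBase α χ)) := by
  obtain ⟨z, hz⟩ := h.exists_lt
  obtain ⟨p, hp⟩ := exists_eq_coe (h.ne_bot x) hx
  obtain ⟨q, hq⟩ := exists_coe_of_mem_Ioo ⟨h.baseInf_lt z, hz⟩
  refine closure_mono ?_ (segment_subset_closure_openSegment (left_mem_segment ℝ x z))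
  rintro _ ⟨s, t, hs, ht, hst, rfl⟩
  rw [support_ofBase h.baseInf_lt]
  exact (le_of_convex_epigraph h.convex hp.le hq.le hs.le ht.le hst).trans_lt
    (combo_lt_baseSup (hp ▸ h.le_baseSup x hx) (hq ▸ hz) hs.le ht hst)

lemma notMem_closure_support (h : IsBase α χ) (hα : 0 < α) {x : E n} (hx : χ x = ⊤) :
    x ∉ closure (Function.support (ofBase α χ)) := by
  have hsub : Function.support (ofBase α χ) ⊆ {x | χ x ≠ ⊤} := by
    rw [support_ofBase h.baseInf_lt]
    exact fun z hz => (lt_of_lt_of_le hz le_top).ne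
  exact fun hcl => closure_minimal hsub (h.compact_dom hα).isClosed hcl hx

theorem baseFn_ofBase (h : IsBase α χ) : baseFn α (ofBase α χ) = χ := by
  funext x
  rcases lt_or_ge (χ x) (baseSup α) with hlt | hge
  · have hmem : χ x ∈ Set.Ioo (baseInf α) (baseSup α) := ⟨h.baseInf_lt x, hlt⟩
    obtain ⟨p, hp⟩ := exists_coe_of_mem_Ioo hmem
    rw [baseFn_of_pos (profile_pos hmem), ofBase_apply, hp, level_profile (hp ▸ hmem)]
  have hzero : ofBase α χ x = 0 := profile_eq_zero hge
  by_cases htop : χ x = ⊤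
  · rcases le_or_gt α 0 with hα | hα
    · rw [htop, ← top_le_iff, ← baseSup_of_nonpos hα]
      exact baseSup_le_baseFn hzero
    · rw [htop, baseFn_of_notMem_closure (h.notMem_closure_support hα htop)]
  · rw [baseFn_of_mem_closure hzero (h.mem_closure_support htop)]
    exact le_antisymm hge (h.le_baseSup x htop)

lemma comp_linearEquiv (h : IsBase α χ) (e : E n ≃ₗ[ℝ] E n) : IsBase α fun x => χ (e x) where
  convex := by
    rintro ⟨a, p⟩ ha ⟨b, q⟩ hb s t hs ht hst
    change χ (e (s • a + t • b)) ≤ ((s * p + t * q : ℝ) : EReal)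
    rw [map_add, map_smul, map_smul]
    exact le_of_convex_epigraph h.convex ha hb hs ht hst
  lower := h.lower.imp fun _ hc => ⟨hc.1, fun x => hc.2 (e x)⟩
  compact_dom hα :=
    e.toContinuousLinearEquiv.toHomeomorph.isCompact_preimage.2 (h.compact_dom hα)
  le_baseSup x := h.le_baseSup (e x)
  exists_lt := by
    obtain ⟨x, hx⟩ := h.exists_lt
    exact ⟨e.symm x, by rwa [e.apply_symm_apply]⟩

lemma reflectFun (h : IsBase α χ) {u : E n} (hu : ‖u‖ = 1) : IsBase α (reflectFun u χ) := by
  have heq : MinkSymm.reflectFun u χ =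
      fun x => χ ((Submodule.span ℝ {u})ᗮ.reflection.toLinearEquiv x) :=
    funext fun x => congrArg χ (reflect_eq_reflection hu x)
  exact heq ▸ h.comp_linearEquiv _

lemma half_mul (h : IsBase α χ) : IsBase α fun x => ((1 / 2 : ℝ) : EReal) * χ x where
  convex := by
    rintro ⟨a, p⟩ ha ⟨b, q⟩ hb s t hs ht hst
    have hle := le_of_convex_epigraph h.convex (half_mul_le_coe_iff.1 ha)
      (half_mul_le_coe_iff.1 hb) hs ht hst
    refine half_mul_le_coe_iff.2 (hle.trans_eq (congrArg _ ?_))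
    simp only [smul_eq_mul, Prod.snd_add, Prod.smul_snd]
    ring
  lower := by
    obtain ⟨c, hc, hcx⟩ := h.lower
    refine ⟨c / 2, baseInf_lt_half hc, fun x => ?_⟩
    rw [← half_mul_coe]
    exact mul_le_mul_of_nonneg_left (hcx x) (EReal.coe_nonneg.2 (by norm_num))
  compact_dom hα := by
    simpa only [ne_eq, half_mul_eq_top_iff] using h.compact_dom hα
  le_baseSup x hx := by
    rw [Ne, half_mul_eq_top_iff] at hx
    obtain ⟨p, hp⟩ := exists_eq_coe (h.ne_bot x) hx
    rw [hp, half_mul_coe]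
    exact (half_lt_baseSup (hp ▸ h.le_baseSup x hx)).le
  exists_lt := by
    obtain ⟨x, hx⟩ := h.exists_lt
    obtain ⟨p, hp⟩ := exists_coe_of_mem_Ioo ⟨h.baseInf_lt x, hx⟩
    refine ⟨x, ?_⟩
    rw [hp, half_mul_coe]
    exact half_lt_baseSup (hp ▸ hx.le)

lemma epiMul_half (h : IsBase α χ) : IsBase α (epiMul (1 / 2) χ) :=
  (h.comp_linearEquiv (LinearEquiv.smulOfNeZero ℝ (E n) (1 / 2 : ℝ)⁻¹ (by norm_num))).half_mul

lemma isCompact_dom_symmetral (h : IsBase α χ) {u : E n} (hu : ‖u‖ = 1) (hα : 0 < α) :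
    IsCompact {x | symmetral u χ x ≠ ⊤} := by
  have himage : {x | symmetral u χ x ≠ ⊤} =
      (fun p : E n × E n => (1 / 2 : ℝ) • (p.1 + reflect u p.2)) ''
        ({x | χ x ≠ ⊤} ×ˢ {x | χ x ≠ ⊤}) := by
    ext x
    constructor
    · intro hx
      obtain ⟨a, b, p, q, ha, hb, rfl, -⟩ :=
        exists_of_symmetral_lt hu h.ne_bot (lt_top_iff_ne_top.2 hx)
      exact ⟨(a, b), ⟨by simp [ha], by simp [hb]⟩, rfl⟩
    · rintro ⟨⟨a, b⟩, ⟨ha, hb⟩, rfl⟩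
      obtain ⟨p, hp⟩ := exists_eq_coe (h.ne_bot a) ha
      obtain ⟨q, hq⟩ := exists_eq_coe (h.ne_bot b) hb
      exact ((symmetral_le hu hp.le hq.le).trans_lt (EReal.coe_lt_top _)).ne
  have hcont := continuous_reflect u
  rw [himage]
  exact ((h.compact_dom hα).prod (h.compact_dom hα)).image (by fun_prop)

lemma symmetral (h : IsBase α χ) {u : E n} (hu : ‖u‖ = 1) : IsBase α (symmetral u χ) where
  convex := convex_epigraph_symmetral hu h.ne_bot h.convex
  lower := h.lower.imp fun _ hc => ⟨hc.1, le_symmetral hu hc.2⟩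
  compact_dom := h.isCompact_dom_symmetral hu
  le_baseSup x hx := by
    obtain ⟨a, b, p, q, ha, hb, rfl, -⟩ :=
      exists_of_symmetral_lt hu h.ne_bot (lt_top_iff_ne_top.2 hx)
    have hmax : ((max p q : ℝ) : EReal) ≤ baseSup α := by
      rw [EReal.coe_strictMono.monotone.map_max, ← ha, ← hb]
      exact max_le (h.le_baseSup a (by simp [ha])) (h.le_baseSup b (by simp [hb]))
    refine (symmetral_le hu (ha.trans_le (EReal.coe_le_coe_iff.2 (le_max_left p q)))
      (hb.trans_le (EReal.coe_le_coe_iff.2 (le_max_right p q)))).trans ?_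
    rwa [add_self_div_two]
  exists_lt := by
    obtain ⟨x, hx⟩ := h.exists_lt
    obtain ⟨p, hp⟩ := exists_coe_of_mem_Ioo ⟨h.baseInf_lt x, hx⟩
    refine ⟨_, (symmetral_le hu hp.le hp.le).trans_lt ?_⟩
    rwa [add_self_div_two, ← hp]

lemma iterSymmetral (h : IsBase α χ) {u : ℕ → E n} (hu : ∀ i, ‖u i‖ = 1) (m : ℕ) :
    IsBase α (iterSymmetral u χ m) := by
  induction m with
  | zero => exact h
  | succ m ih => exact ih.symmetral (hu m)

lemma alphaSymmetral_ofBase (h : IsBase α χ) {u : E n} (hu : ‖u‖ = 1) :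
    alphaSymmetral α u (ofBase α χ) = ofBase α (MinkSymm.symmetral u χ) := by
  have hreflect : MinkSymm.reflectFun u (ofBase α χ) = ofBase α (MinkSymm.reflectFun u χ) := rfl
  rw [alphaSymmetral, asplund, homothety, homothety, hreflect, h.baseFn_ofBase,
    (h.reflectFun hu).baseFn_ofBase, h.epiMul_half.baseFn_ofBase,
    (h.reflectFun hu).epiMul_half.baseFn_ofBase, MinkSymm.symmetral]

theorem iterAlphaSymmetral_ofBase (h : IsBase α χ) {u : ℕ → E n} (hu : ∀ i, ‖u i‖ = 1) (m : ℕ) :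
    iterAlphaSymmetral α u (ofBase α χ) m = ofBase α (MinkSymm.iterSymmetral u χ m) := by
  induction m with
  | zero => rfl
  | succ m ih =>
    rw [iterAlphaSymmetral, ih, (h.iterSymmetral hu m).alphaSymmetral_ofBase (hu m),
      MinkSymm.iterSymmetral]

end IsBase

lemma IsConvC.isBase_zero (h : IsConvC χ) : IsBase 0 χ where
  convex := h.convex
  lower := h.isBddConvex.bddBelow.imp fun c hc => ⟨by simp [baseInf], hc⟩
  compact_dom h0 := absurd h0 (lt_irrefl 0)
  le_baseSup x _ := baseSup_of_nonpos le_rfl ▸ le_top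
  exists_lt := by
    obtain ⟨x, hx⟩ := h.dom_nonempty
    exact ⟨x, baseSup_of_nonpos le_rfl ▸ lt_top_iff_ne_top.2 hx⟩

end Base

section AlphaClass

variable {n : ℕ} {α : ℝ} {f : E n → ℝ}

namespace IsAlphaClass

lemma pos_of_ne (h : IsAlphaClass α f) {x : E n} (hx : f x ≠ 0) : 0 < f x :=
  (h.nonneg x).lt_of_ne hx.symm

lemma baseFn_of_ne (h : IsAlphaClass α f) {x : E n} (hx : f x ≠ 0) :
    baseFn α f x = level α (f x) :=
  baseFn_of_pos (h.pos_of_ne hx)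

lemma level_mem_Ioo (h : IsAlphaClass α f) {x : E n} (hx : f x ≠ 0) :
    (level α (f x) : EReal) ∈ Set.Ioo (baseInf α) (baseSup α) :=
  MinkSymm.level_mem_Ioo (h.pos_of_ne hx)

theorem ofBase_baseFn (h : IsAlphaClass α f) : ofBase α (baseFn α f) = f := by
  funext x
  rw [ofBase_apply]
  by_cases hx : f x = 0
  · rw [hx, profile_eq_zero (baseSup_le_baseFn hx)]
  · rw [h.baseFn_of_ne hx, profile_level (h.pos_of_ne hx)]

lemma baseInf_lt_baseFn (h : IsAlphaClass α f) (x : E n) : baseInf α < baseFn α f x := by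
  by_cases hx : f x = 0
  · have hlt : baseInf α < baseSup α := (MinkSymm.level_mem_Ioo one_pos).1.trans
      (MinkSymm.level_mem_Ioo one_pos).2
    exact hlt.trans_le (baseSup_le_baseFn hx)
  · exact h.baseFn_of_ne hx ▸ (h.level_mem_Ioo hx).1

lemma baseFn_le_baseSup (h : IsAlphaClass α f) {x : E n}
    (hcl : x ∈ closure (Function.support f)) : baseFn α f x ≤ baseSup α := by
  by_cases hx : f x = 0
  · exact (baseFn_of_mem_closure hx hcl).le
  · exact h.baseFn_of_ne hx ▸ (h.level_mem_Ioo hx).2.le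

lemma baseFn_le_iff (h : IsAlphaClass α f) {τ : ℝ}
    (hτ : (τ : EReal) ∈ Set.Ioo (baseInf α) (baseSup α)) (x : E n) :
    baseFn α f x ≤ τ ↔ profile α τ ≤ f x := by
  by_cases hx : f x = 0
  · rw [hx]
    exact iff_of_false (hτ.2.trans_le (baseSup_le_baseFn hx)).not_ge (profile_pos hτ).not_ge
  · rw [h.baseFn_of_ne hx, EReal.coe_le_coe_iff, level_le_iff (h.pos_of_ne hx) hτ.1]

lemma baseFn_combo_le (h : IsAlphaClass α f) {a b : E n} (ha : f a ≠ 0) (hb : f b ≠ 0) {s t : ℝ}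
    (hs : 0 ≤ s) (ht : 0 ≤ t) (hst : s + t = 1) :
    baseFn α f (s • a + t • b) ≤ ((s * level α (f a) + t * level α (f b) : ℝ) : EReal) := by
  have ha' := h.level_mem_Ioo ha
  have hb' := h.level_mem_Ioo hb
  rw [h.baseFn_le_iff (combo_mem_Ioo ha' hb' hs ht hst), ← alphaMean_profile ha' hb' hs ht hst,
    profile_level (h.pos_of_ne ha), profile_level (h.pos_of_ne hb), eq_sub_of_add_eq' hst]
  exact h.concave.2 a ha b hb s ⟨hs, by linarith⟩

lemma isCompact_closure_support (h : IsAlphaClass α f) (hα : 0 < α) :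
    IsCompact (closure (Function.support f)) := by
  obtain ⟨x₀, hx₀⟩ := h.proper
  set τ := 1 / 2 * (1 / α) + 1 / 2 * level α (f x₀) with hτ
  have hτ_mem : (τ : EReal) ∈ Set.Ioo (baseInf α) (baseSup α) :=
    ⟨by rw [baseInf, if_neg hα.not_gt]; exact EReal.bot_lt_coe _,
      combo_lt_baseSup (baseSup_of_pos hα).ge (h.level_mem_Ioo hx₀).2 (by norm_num) (by norm_num)
        (by norm_num)⟩
  obtain ⟨K, hK, hKf⟩ :=
    mem_cocompact.1 (h.vanish.eventually (gt_mem_nhds (profile_pos hτ_mem)))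
  -- midpoints between `x₀` and the support stay in a superlevel set of `f`
  have hmid : ∀ y, f y ≠ 0 → (1 / 2 : ℝ) • x₀ + (1 / 2 : ℝ) • y ∈ K := fun y hy => by
    have hlevel := (h.level_mem_Ioo hy).2
    rw [baseSup_of_pos hα, EReal.coe_lt_coe_iff] at hlevel
    have hle : baseFn α f ((1 / 2 : ℝ) • x₀ + (1 / 2 : ℝ) • y) ≤ τ :=
      (h.baseFn_combo_le hx₀ hy (by norm_num) (by norm_num) (by norm_num)).trans
        (EReal.coe_le_coe_iff.2 (by linarith))
    by_contra hnot
    exact (hKf hnot).not_ge ((h.baseFn_le_iff hτ_mem _).1 hle)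
  refine Bornology.IsBounded.isCompact_closure
    ((hK.image (by fun_prop : Continuous fun x : E n => (2 : ℝ) • x - x₀)).isBounded.subset ?_)
  exact fun y hy => ⟨_, hmid y hy, by module⟩

lemma isClosed_baseFn_le (h : IsAlphaClass α f) (y : EReal) : IsClosed {x | baseFn α f x ≤ y} := by
  rcases le_or_gt y (baseInf α) with hinf | hinf
  · convert isClosed_empty
    exact Set.eq_empty_of_forall_notMem fun x hx =>
      ((hinf.trans_lt (h.baseInf_lt_baseFn x)).trans_le hx).false
  rcases lt_or_ge y (baseSup α) with hsup | hsup
  · obtain ⟨τ, rfl⟩ := exists_coe_of_mem_Ioo ⟨hinf, hsup⟩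
    simp only [h.baseFn_le_iff ⟨hinf, hsup⟩]
    exact h.usc.isClosed_preimage (profile α τ)
  rcases eq_or_ne y ⊤ with rfl | htop
  · simp
  · convert isClosed_closure (s := Function.support f)
    refine Set.Subset.antisymm (fun x hx => ?_) fun x hx => (h.baseFn_le_baseSup hx).trans hsup
    by_contra hcl
    rw [Set.mem_ofPred_eq, baseFn_of_notMem_closure hcl, top_le_iff] at hx
    exact htop hx

lemma lowerSemicontinuous_baseFn (h : IsAlphaClass α f) : LowerSemicontinuous (baseFn α f) :=
  lowerSemicontinuous_iff_isClosed_preimage.2 h.isClosed_baseFn_le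

lemma tendsto_baseFn_cocompact (h : IsAlphaClass α f) :
    Tendsto (baseFn α f) (cocompact (E n)) (𝓝 ⊤) := by
  rw [EReal.tendsto_nhds_top_iff_real]
  intro τ
  rcases le_or_gt (τ : EReal) (baseInf α) with hinf | hinf
  · exact Eventually.of_forall fun x => hinf.trans_lt (h.baseInf_lt_baseFn x)
  rcases lt_or_ge (τ : EReal) (baseSup α) with hsup | hsup
  · filter_upwards [h.vanish.eventually (gt_mem_nhds (profile_pos ⟨hinf, hsup⟩))] with x hx
    rw [← not_le, h.baseFn_le_iff ⟨hinf, hsup⟩]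
    exact not_le.2 hx
  · have hα : 0 < α := not_le.1 fun hα =>
      (EReal.coe_lt_top τ).not_ge (baseSup_of_nonpos hα ▸ hsup)
    filter_upwards [(h.isCompact_closure_support hα).compl_mem_cocompact] with x hx
    rw [baseFn_of_notMem_closure hx]
    exact EReal.coe_lt_top τ

/-- The epigraph is the closure of its part above the support of `f`, which is convex by
`α`-concavity. -/
lemma convex_baseFn (h : IsAlphaClass α f) :
    Convex ℝ {p : E n × ℝ | baseFn α f p.1 ≤ (p.2 : EReal)} := by
  set S : Set (E n × ℝ) := {p | f p.1 ≠ 0 ∧ level α (f p.1) ≤ p.2}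
  have hSconv : Convex ℝ S := by
    rintro ⟨a, p⟩ ⟨ha, hap⟩ ⟨b, q⟩ ⟨hb, hbq⟩ s t hs ht hst
    have hmem : s • a + t • b ∈ Function.support f := h.concave.1 ha hb hs ht hst
    have hle := h.baseFn_combo_le ha hb hs ht hst
    rw [h.baseFn_of_ne hmem, EReal.coe_le_coe_iff] at hle
    exact ⟨hmem, hle.trans (add_le_add (mul_le_mul_of_nonneg_left hap hs)
      (mul_le_mul_of_nonneg_left hbq ht))⟩
  have hclosed : IsClosed {p : E n × ℝ | baseFn α f p.1 ≤ (p.2 : EReal)} :=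
    h.lowerSemicontinuous_baseFn.isClosed_epigraph.preimage
      (continuous_fst.prodMk (continuous_coe_real_ereal.comp continuous_snd))
  suffices heq : {p : E n × ℝ | baseFn α f p.1 ≤ (p.2 : EReal)} = closure S from
    heq ▸ hSconv.closure
  refine Set.Subset.antisymm ?_ (closure_minimal ?_ hclosed)
  · rintro ⟨a, p⟩ (hp : baseFn α f a ≤ p)
    by_cases ha : f a = 0
    · have hcl : a ∈ closure (Function.support f) := by
        by_contra hcl
        exact (EReal.coe_lt_top p).not_ge (baseFn_of_notMem_closure hcl ▸ hp)
      refine map_mem_closure (f := fun x => (x, p)) (by fun_prop) hcl fun x hx => ⟨hx, ?_⟩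
      exact (EReal.coe_lt_coe_iff.1 ((h.level_mem_Ioo hx).2.trans_le
        ((baseSup_le_baseFn ha).trans hp))).le
    · exact subset_closure ⟨ha, EReal.coe_le_coe_iff.1 (h.baseFn_of_ne ha ▸ hp)⟩
  · rintro ⟨a, p⟩ ⟨ha, hp⟩
    exact (h.baseFn_of_ne ha).trans_le (EReal.coe_le_coe_iff.2 hp)

theorem isConvC_baseFn (h : IsAlphaClass α f) : IsConvC (baseFn α f) where
  convex := h.convex_baseFn
  ne_bot x := (bot_le.trans_lt (h.baseInf_lt_baseFn x)).ne'
  dom_nonempty := h.proper.imp fun _ hx => h.baseFn_of_ne hx ▸ EReal.coe_ne_top _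
  lsc := h.lowerSemicontinuous_baseFn
  coercive := h.tendsto_baseFn_cocompact

theorem isBase_baseFn (h : IsAlphaClass α f) : IsBase α (baseFn α f) where
  convex := h.convex_baseFn
  lower := by
    obtain ⟨x₀, hx₀⟩ := h.isConvC_baseFn.exists_forall_le
    obtain ⟨x₁, hx₁⟩ := h.isConvC_baseFn.dom_nonempty
    obtain ⟨c, hc⟩ := exists_eq_coe (h.isConvC_baseFn.ne_bot x₀)
      (ne_top_of_le_ne_top hx₁ (hx₀ x₁))
    exact ⟨c, hc ▸ h.baseInf_lt_baseFn x₀, fun x => hc ▸ hx₀ x⟩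
  compact_dom hα := by
    convert h.isCompact_closure_support hα
    refine Set.Subset.antisymm (fun x hx => not_not.1 (mt baseFn_of_notMem_closure hx))
      fun x hx => ?_
    exact ne_top_of_le_ne_top (baseSup_of_pos hα ▸ EReal.coe_ne_top _) (h.baseFn_le_baseSup hx)
  le_baseSup x hx := h.baseFn_le_baseSup (not_not.1 (mt baseFn_of_notMem_closure hx))
  exists_lt := h.proper.imp fun _ hx => h.baseFn_of_ne hx ▸ (h.level_mem_Ioo hx).2

end IsAlphaClass

end AlphaClass

section EpiLimits

variable {n : ℕ} {α : ℝ} {ψs : ℕ → E n → EReal} {φ : E n → EReal}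

lemma exists_tendsto_forall_apply_eq {X : Type*} [TopologicalSpace X] {k : ℕ → ℕ}
    (hk : StrictMono k) {ys : ℕ → X} {p : X} (hys : Tendsto ys atTop (𝓝 p)) :
    ∃ xs : ℕ → X, Tendsto xs atTop (𝓝 p) ∧ ∀ j, xs (k j) = ys j := by
  refine ⟨Function.extend k ys fun _ => p, ?_, hk.injective.extend_apply ys _⟩
  refine tendsto_def.2 fun s hs => ?_
  obtain ⟨J, hJ⟩ := eventually_atTop.1 (hys.eventually_mem hs)
  filter_upwards [eventually_ge_atTop (k J)] with m hm
  by_cases hmk : ∃ j, k j = m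
  · obtain ⟨j, rfl⟩ := hmk
    rw [Set.mem_preimage, hk.injective.extend_apply]
    exact hJ j (hk.le_iff_le.1 hm)
  · rw [Set.mem_preimage, Function.extend_apply' _ _ _ hmk]
    exact mem_of_mem_nhds hs

namespace EpiConverges

lemma le_of_forall_le (h : EpiConverges ψs φ) {c : EReal} (hc : ∀ m x, c ≤ ψs m x) (x : E n) :
    c ≤ φ x := by
  obtain ⟨xs, -, hlim⟩ := (h x).2
  exact ge_of_tendsto' hlim fun m => hc m _

lemma exists_mem_le (h : EpiConverges ψs φ) {K : Set (E n)} (hK : IsCompact K) {c : EReal}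
    (hc : ∀ m, ∃ p ∈ K, ψs m p ≤ c) : ∃ p ∈ K, φ p ≤ c := by
  choose ps hps hle using hc
  obtain ⟨p, hp, k, hk, hlim⟩ := hK.tendsto_subseq hps
  obtain ⟨xs, hxs, heq⟩ := exists_tendsto_forall_apply_eq hk hlim
  refine ⟨p, hp, ((h p).1 xs hxs).trans (liminf_le_of_frequently_le' ?_)⟩
  refine frequently_atTop.2 fun M => ⟨k M, hk.le_apply, ?_⟩
  rw [heq]
  exact hle _

lemma hypoConverges_ofBase (h : EpiConverges ψs φ) (hφ : ∀ x, baseInf α < φ x) :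
    HypoConverges (fun m => ofBase α (ψs m)) (ofBase α φ) := by
  refine fun x => ⟨fun xs hxs => EReal.le_of_forall_lt_iff_le.1 fun z hz => ?_, ?_⟩
  · obtain ⟨s, hs, hst⟩ := exists_lt_forall_profile_lt (hφ x) (EReal.coe_lt_coe_iff.1 hz)
    have hev := eventually_lt_of_lt_liminf (hs.trans_le ((h x).1 xs hxs))
    exact limsup_le_of_le (h := hev.mono fun m hm => EReal.coe_le_coe_iff.2 (hst _ hm).le)
  · obtain ⟨xs, hxs, hlim⟩ := (h x).2
    exact ⟨xs, hxs, (continuousAt_profile (hφ x)).tendsto.comp hlim⟩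

end EpiConverges

lemma IsBase.baseInf_lt_of_epiConverges {χ : E n → EReal} (hχ : IsBase α χ) {u : ℕ → E n}
    (hu : ∀ i, ‖u i‖ = 1) (h : EpiConverges (MinkSymm.iterSymmetral u χ) φ) (x : E n) :
    baseInf α < φ x := by
  obtain ⟨c, hc, hcx⟩ := hχ.lower
  exact hc.trans_le (h.le_of_forall_le (fun m => le_iterSymmetral hu hcx m) x)

theorem IsBase.rotationInvariant_and_exists_hypoConverges {χ : E n → EReal} (hχ : IsBase α χ)
    (hφ : IsEpiSymmetrization χ φ) : RotationInvariant (ofBase α φ) ∧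
      ∃ u : ℕ → E n, (∀ i, ‖u i‖ = 1) ∧
        HypoConverges (iterAlphaSymmetral α u (ofBase α χ)) (ofBase α φ) := by
  obtain ⟨-, hrot, u, hu, hepi⟩ := hφ
  refine ⟨fun T x => congrArg (profile α) (hrot T x), u, hu, ?_⟩
  rw [funext (hχ.iterAlphaSymmetral_ofBase hu)]
  exact hepi.hypoConverges_ofBase (hχ.baseInf_lt_of_epiConverges hu hepi)

end EpiLimits

section FullDimension

variable {n : ℕ} {α : ℝ} {f : E n → ℝ} {ψ φ : E n → EReal}

lemma exists_closedBall_le_iterSymmetral {u : ℕ → E n} (hu : ∀ i, ‖u i‖ = 1) {x₀ : E n} {r c : ℝ}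
    (h : ∀ x ∈ Metric.closedBall x₀ r, ψ x ≤ c) (m : ℕ) :
    ∃ y : E n, ‖y‖ ≤ ‖x₀‖ ∧ ∀ x ∈ Metric.closedBall y r, iterSymmetral u ψ m x ≤ c := by
  simp only [mem_closedBall_iff_norm] at h ⊢
  induction m with
  | zero => exact ⟨x₀, le_rfl, h⟩
  | succ m ih =>
    obtain ⟨y, hy, hyc⟩ := ih
    set y' : E n := (1 / 2 : ℝ) • (y + reflect (u m) y) with hy'
    refine ⟨y', ?_, fun x hx => ?_⟩
    · have hadd := norm_add_le y (reflect (u m) y)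
      rw [norm_reflect (hu m)] at hadd
      rw [hy', norm_smul, Real.norm_of_nonneg (by norm_num)]
      linarith
    · have hle := symmetral_le (hu m) (hyc (y + (x - y')) (by rwa [add_sub_cancel_left]))
        (hyc (y + reflect (u m) (x - y')) (by rwa [add_sub_cancel_left, norm_reflect (hu m)]))
      have hx_eq :
          (1 / 2 : ℝ) • (y + (x - y') + reflect (u m) (y + reflect (u m) (x - y'))) = x := by
        rw [reflect_add, reflect_reflect (hu m), hy']
        module
      rwa [hx_eq, add_self_div_two] at hle

lemma convex_sublevel (h : Convex ℝ {p : E n × ℝ | ψ p.1 ≤ (p.2 : EReal)}) (c : ℝ) :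
    Convex ℝ {x | ψ x ≤ (c : EReal)} := fun x hx y hy s t hs ht hst => by
  have hle := le_of_convex_epigraph h hx hy hs ht hst
  rwa [← add_mul, hst, one_mul] at hle

lemma IsAlphaClass.exists_affineSpan_sublevel_eq_top (h : IsAlphaClass α f) :
    ∃ c : ℝ, (c : EReal) < baseSup α ∧ affineSpan ℝ {x | baseFn α f x ≤ (c : EReal)} = ⊤ := by
  obtain ⟨t, htf, htspan, hind⟩ := exists_affineIndependent ℝ (E n) (Function.support f)
  rw [h.full_dim] at htspan
  have htne : t.Nonempty := by
    rw [Set.nonempty_iff_ne_empty]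
    rintro rfl
    exact AffineSubspace.bot_ne_top ℝ (E n) (E n) (AffineSubspace.span_empty ℝ (E n) (E n) ▸ htspan)
  obtain ⟨a, ha, hmax⟩ := Set.exists_max_image t (fun x => level α (f x))
    (finite_set_of_fin_dim_affineIndependent ℝ hind) htne
  refine ⟨level α (f a), (h.level_mem_Ioo (htf ha)).2, top_le_iff.1 ?_⟩
  exact htspan ▸ affineSpan_mono ℝ fun x hx =>
    (h.baseFn_of_ne (htf hx)).trans_le (EReal.coe_le_coe_iff.2 (hmax x hx))

lemma IsAlphaClass.exists_closedBall_baseFn_le (h : IsAlphaClass α f) :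
    ∃ (x₀ : E n) (r c : ℝ), 0 < r ∧ (c : EReal) < baseSup α ∧
      ∀ x ∈ Metric.closedBall x₀ r, baseFn α f x ≤ c := by
  obtain ⟨c, hc, hspan⟩ := h.exists_affineSpan_sublevel_eq_top
  obtain ⟨x₀, hx₀⟩ :=
    (convex_sublevel h.convex_baseFn c).interior_nonempty_iff_affineSpan_eq_top.2 hspan
  obtain ⟨r, hr, hball⟩ :=
    Metric.nhds_basis_closedBall.mem_iff.1 (mem_interior_iff_mem_nhds.1 hx₀)
  exact ⟨x₀, r, c, hr, hc, hball⟩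

lemma affineSpan_eq_top_of_rotation {S : Set (E n)} (hS : Convex ℝ S)
    (hrot : ∀ T : E n ≃ₗᵢ[ℝ] E n, ∀ x ∈ S, T x ∈ S) {p : E n} (hp : p ∈ S) (hp0 : p ≠ 0) :
    affineSpan ℝ S = ⊤ := by
  have hsphere : Metric.sphere 0 ‖p‖ ⊆ S := fun q hq => by
    have hmem := hrot (Submodule.span ℝ {p - q})ᗮ.reflection p hp
    rwa [Submodule.reflection_sub (mem_sphere_zero_iff_norm.1 hq).symm] at hmem
  have : Nontrivial (E n) := ⟨p, 0, hp0⟩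
  have hball : Metric.closedBall 0 ‖p‖ ⊆ S :=
    convexHull_sphere_eq_closedBall (0 : E n) (norm_nonneg p) ▸ convexHull_min hsphere hS
  exact hS.interior_nonempty_iff_affineSpan_eq_top.1
    ⟨0, mem_interior_iff_mem_nhds.2
      (mem_of_superset (Metric.closedBall_mem_nhds 0 (norm_pos_iff.2 hp0)) hball)⟩

lemma lt_baseSup_and_alphaMean_le_ofBase
    (hconv : Convex ℝ {p : E n × ℝ | φ p.1 ≤ (p.2 : EReal)}) (hφ : ∀ x, baseInf α < φ x)
    {x y : E n} (hx : φ x < baseSup α) (hy : φ y < baseSup α) {s t : ℝ} (hs : 0 ≤ s) (ht : 0 ≤ t)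
    (hst : s + t = 1) : φ (s • x + t • y) < baseSup α ∧
      alphaMean α s t (ofBase α φ x) (ofBase α φ y) ≤ ofBase α φ (s • x + t • y) := by
  have hx' : φ x ∈ Set.Ioo (baseInf α) (baseSup α) := ⟨hφ x, hx⟩
  have hy' : φ y ∈ Set.Ioo (baseInf α) (baseSup α) := ⟨hφ y, hy⟩
  obtain ⟨a, ha⟩ := exists_coe_of_mem_Ioo hx'
  obtain ⟨b, hb⟩ := exists_coe_of_mem_Ioo hy'
  have hle := le_of_convex_epigraph hconv ha.le hb.le hs ht hst
  rw [ha] at hx'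
  rw [hb] at hy'
  refine ⟨hle.trans_lt (combo_mem_Ioo hx' hy' hs ht hst).2, ?_⟩
  rw [ofBase_apply, ofBase_apply, ha, hb, alphaMean_profile hx' hy' hs ht hst]
  exact profile_le_profile (hφ _) hle

lemma alphaConcave_ofBase (hconv : Convex ℝ {p : E n × ℝ | φ p.1 ≤ (p.2 : EReal)})
    (hφ : ∀ x, baseInf α < φ x) : AlphaConcave α (ofBase α φ) := by
  rw [AlphaConcave, support_ofBase hφ]
  exact ⟨fun x hx y hy s t hs ht hst =>
      (lt_baseSup_and_alphaMean_le_ofBase hconv hφ hx hy hs ht hst).1,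
    fun x hx y hy t ht => (lt_baseSup_and_alphaMean_le_ofBase hconv hφ hx hy ht.1
      (sub_nonneg.2 ht.2) (add_sub_cancel t 1)).2⟩

lemma isAlphaClass_ofBase (h : IsConvC φ) (hφ : ∀ x, baseInf α < φ x) (hrot : RotationInvariant φ)
    {p : E n} (hp0 : p ≠ 0) (hp : φ p < baseSup α) : IsAlphaClass α (ofBase α φ) where
  nonneg x := profile_nonneg (φ x)
  concave := alphaConcave_ofBase h.convex hφ
  proper := ⟨p, (profile_ne_zero_iff (hφ p)).2 hp⟩
  usc x y hy := by
    obtain ⟨s, hs, hst⟩ := exists_lt_forall_profile_lt (hφ x) hy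
    exact (h.lsc x s hs).mono fun z => hst (φ z)
  full_dim := by
    refine affineSpan_eq_top_of_rotation (alphaConcave_ofBase h.convex hφ).1 (fun T x hx => ?_)
      ((profile_ne_zero_iff (hφ p)).2 hp) hp0
    rwa [Function.mem_support, ofBase_apply, hrot, ← ofBase_apply]
  vanish := profile_top (α := α) ▸ continuousAt_profile_top.tendsto.comp h.coercive

lemma exists_mem_closedBall_le_norm (hn : 0 < n) (y : E n) {r : ℝ} (hr : 0 ≤ r) :
    ∃ p ∈ Metric.closedBall y r, r ≤ ‖p‖ := by
  obtain ⟨v, hv⟩ := exists_norm_eq_one hn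
  have hrv : ‖r • v‖ = r := by rw [norm_smul, hv, mul_one, Real.norm_of_nonneg hr]
  by_contra! hlt
  have hplus := hlt (y + r • v) (by rw [mem_closedBall_iff_norm, add_sub_cancel_left, hrv])
  have hminus := hlt (y - r • v)
    (by rw [mem_closedBall_iff_norm, sub_sub_cancel_left, norm_neg, hrv])
  have htri := norm_sub_le (y + r • v) (y - r • v)
  rw [show y + r • v - (y - r • v) = (2 : ℝ) • r • v by module, norm_smul, hrv,
    Real.norm_two] at htri
  linarith

theorem IsAlphaClass.of_isEpiSymmetrization (hn : 0 < n) (h : IsAlphaClass α f)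
    (hφ : IsEpiSymmetrization (baseFn α f) φ) : IsAlphaClass α (ofBase α φ) := by
  obtain ⟨hconv, hrot, u, hu, hepi⟩ := hφ
  obtain ⟨x₀, r, c, hr, hc, hball⟩ := h.exists_closedBall_baseFn_le
  have hK : IsCompact (Metric.closedBall (0 : E n) (‖x₀‖ + r) ∩ {p | r ≤ ‖p‖}) :=
    (isCompact_closedBall 0 _).inter_right (isClosed_le continuous_const continuous_norm)
  obtain ⟨p, ⟨-, hp⟩, hpc⟩ := hepi.exists_mem_le hK (c := c) fun m => by
    obtain ⟨y, hy, hyc⟩ := exists_closedBall_le_iterSymmetral hu hball m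
    obtain ⟨p, hpy, hp⟩ := exists_mem_closedBall_le_norm hn y hr.le
    refine ⟨p, ⟨?_, hp⟩, hyc p hpy⟩
    rw [mem_closedBall_zero_iff]
    linarith [norm_le_norm_add_norm_sub' p y, mem_closedBall_iff_norm.1 hpy]
  exact isAlphaClass_ofBase hconv (h.isBase_baseFn.baseInf_lt_of_epiConverges hu hepi) hrot
    (norm_pos_iff.1 (hr.trans_le hp)) (hpc.trans_lt hc)

end FullDimension

end MinkSymm

theorem lemma4p1 (n : ℕ) (hn : 0 < n) :
    -- every `ψ ∈ Conv_c(ℝⁿ)` has an epi-symmetrization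
    (∀ ψ : E n → EReal, IsConvC ψ →
      ∃ φ : E n → EReal, IsConvC φ ∧ RotationInvariant φ ∧
        ∃ u : ℕ → E n, (∀ i, ‖u i‖ = 1) ∧ EpiConverges (iterSymmetral u ψ) φ) ∧
    -- every `f ∈ C_α(ℝⁿ)` has a hypo-symmetrization; each one lies in `C_α(ℝⁿ)`, is rotation
    -- invariant and is the hypo-limit of successive `α`-Minkowski symmetrals of `f`
    (∀ (α : ℝ) (f : E n → ℝ), IsAlphaClass α f →
      (∃ g : E n → ℝ, IsHypoSymmetrization α f g) ∧
      ∀ g : E n → ℝ, IsHypoSymmetrization α f g →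
        IsAlphaClass α g ∧ RotationInvariant g ∧
          ∃ u : ℕ → E n, (∀ i, ‖u i‖ = 1) ∧ HypoConverges (iterAlphaSymmetral α u f) g) ∧
    -- the same for `α = 0` and `f ∈ LC_c(ℝⁿ)`, whose support may be lower-dimensional
    (∀ f : E n → ℝ, IsLCc f →
      (∃ g : E n → ℝ, IsHypoSymmetrization 0 f g) ∧
      ∀ g : E n → ℝ, IsHypoSymmetrization 0 f g →
        IsLCc g ∧ RotationInvariant g ∧
          ∃ u : ℕ → E n, (∀ i, ‖u i‖ = 1) ∧ HypoConverges (iterAlphaSymmetral 0 u f) g) := by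
  refine ⟨fun ψ hψ => exists_epiSymmetrization hn hψ, fun α f hf => ⟨?_, ?_⟩, ?_⟩
  · obtain ⟨φ, hφ⟩ := exists_epiSymmetrization hn hf.isConvC_baseFn
    exact ⟨_, φ, hφ, rfl⟩
  · rintro g ⟨φ, hφ, rfl⟩
    have h := hf.isBase_baseFn.rotationInvariant_and_exists_hypoConverges hφ
    rw [hf.ofBase_baseFn] at h
    exact ⟨hf.of_isEpiSymmetrization hn hφ, h⟩
  · rintro f ⟨ψ, hψ, rfl⟩
    simp only [IsHypoSymmetrization, hψ.isBase_zero.baseFn_ofBase]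
    refine ⟨?_, ?_⟩
    · obtain ⟨φ, hφ⟩ := exists_epiSymmetrization hn hψ
      exact ⟨_, φ, hφ, rfl⟩
    · rintro g ⟨φ, hφ, rfl⟩
      exact ⟨⟨φ, hφ.1, rfl⟩, hψ.isBase_zero.rotationInvariant_and_exists_hypoConverges hφ⟩
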